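/- All graphs are finite. A 1-graph is a tuple $g=(\mathcal V,\mathcal H,\nu,\iota)$ with sets of vertices $\mathcal V$ and half-edges $\mathcal H$, a map $\nu:\mathcal H\to\mathcal V$ and an involution $\iota$ of $\mathcal H$. A 2-graph $G=(\mathcal V,\mathcal H,\nu,\iota;\mathcal S,\mu,\sigma_1,\sigma_2)$ has in addition a set of strand sections $\mathcal S$, a map $\mu:\mathcal S\to\mathcal H$, a fixed-point free involution $\sigma_1$ of $\mathcal S$ with $\nu\mu\sigma_1=\nu\mu$, and an involution $\sigma_2$ of $\mathcal S$ with $\iota\mu=\mu\sigma_2$ such that $\sigma_2(s)=s$ iff $\iota(\mu(s))=\mu(s)$. The edges of $G$ are the two-element orbits of $\iota$; together with the two-element orbits of $\sigma_2$ on adjacent strand sections they are called stranded edges. The vertex graph of $v\in\mathcal V$ is the 1-graph $(\nu^{-1}(v),(\nu\mu)^{-1}(v),\mu|,\sigma_1|)$. A subgraph $H\subset G$ is obtained by keeping only a subset of the stranded edges (a half-edge or strand section that is in no kept stranded edge becomes a fixed point of the respective involution, i.e. external). The contraction $G/H$ has the connected components of $H$ as vertices and the half-edges and strand sections external in $H$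 as half-edges and strand sections, with the induced adjacency maps; its stranded edges are those of $G$ not in $H$, and its $\sigma_1$ pairs the first and the last strand section of every external face of $H$, i.e. of every maximal alternating $\sigma_1,\sigma_2$-chain of $H$ whose ends are external. A residue is a 2-graph without edges. Let $\mathbf G_1$, $\mathbf G_2$ be the sets of isomorphism classes of 1-graphs and of 2-graphs, and $\mathbf R^*\subset\mathbf G_2$ the set of residues. Let $\mathcal G$ be the commutative $\mathbb Q$-algebra with basis $\mathbf G_2$, product given by disjoint union and unit the empty 2-graph, augmented by (i.e. localized at) formal inverses $r^{-1}$ of all residues $r\in\mathbf R^*$, and let $u:\mathbb Q\to\mathcal G$ be its unit map. Theorem 2. (a) There are algebra homomorphisms $\Delta:\mathcal G\to\mathcal G\otimes\mathcal G$ and $\epsilon:\mathcal G\to\mathbb Q$ with $$\Delta(\Gamma)=\sum_{\Theta\subset\Gamma}\Theta\otimes\Gamma/\Theta,\qquad \epsilon(\Gamma)=1\text{ if }\Gamma\in\mathbf R^*,\quad \epsilon(\Gamma)=0\text{ otherwise}\qquad(\Gamma\in\mathbf G_2),$$ which make $\mathcal G$ a bialgebra (coassociative and counital), and $\mathcal G$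 is a Hopf algebra: there is a unique linear map $S:\mathcal G\to\mathcal G$, the antipode, with $S*\mathrm{id}=\mathrm{id}*S=u\circ\epsilon$, where $\phi*\psi:=m\circ(\phi\otimes\psi)\circ\Delta$ is the convolution product. (b) For every commutative unital $\mathbb Q$-algebra $\mathcal A$ with unit map $u_{\mathcal A}$, the algebra homomorphisms $\mathcal G\to\mathcal A$ form a group under convolution, with neutral element $u_{\mathcal A}\circ\epsilon$ and inverse $\phi\mapsto\phi\circ S$. (c) For every $\mathbf V\subset\mathbf G_1$, let $\mathbf G_2(\mathbf V)$ be the set of 2-graphs all of whose vertex graphs are in $\mathbf V$, and $\overline{\mathbf G_2(\mathbf V)}$ its contraction closure, i.e. the set of all $\Gamma/\Theta$ with $\Theta\subset\Gamma\in\mathbf G_2(\mathbf V)$. The subalgebra of $\mathcal G$ generated by $\overline{\mathbf G_2(\mathbf V)}$ is a subbialgebra, and, augmented by the inverses $r^{-1}$ of the residues $r\in\overline{\mathbf G_2(\mathbf V)}\cap\mathbf R^*$, it is a Hopf subalgebra, i.e. a subalgebra $B$ with $\Delta(B)\subset B\otimes B$ and $S(B)\subset B$. -/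

import Mathlib

universe u

open scoped TensorProduct

noncomputable section

/-! ### Graphs and vertex types -/

/-- A finite graph (1-graph): vertices, half-edges, the adjacency map and an involution on the
half-edges, whose two-element orbits are the edges and whose fixed points are the legs. -/
structure OneGraph where
  V : Type
  H : Type
  [finV : Finite V]
  [finH : Finite H]
  ν : H → V
  ι : H → H
  ι_invol : Function.Involutive ι

attribute [instance] OneGraph.finV OneGraph.finH

namespace OneGraph

/-- Isomorphisms (relabellings) of 1-graphs. -/
structure Iso (g g' : OneGraph) where
  eV : g.V ≃ g'.V
  eH : g.H ≃ g'.H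
  map_ν : ∀ h, g'.ν (eH h) = eV (g.ν h)
  map_ι : ∀ h, g'.ι (eH h) = eH (g.ι h)

def Iso.refl (g : OneGraph) : Iso g g :=
  ⟨Equiv.refl _, Equiv.refl _, fun _ => rfl, fun _ => rfl⟩

def Iso.symm {g g' : OneGraph} (e : Iso g g') : Iso g' g where
  eV := e.eV.symm
  eH := e.eH.symm
  map_ν h := by rw [Equiv.eq_symm_apply, ← e.map_ν, Equiv.apply_symm_apply]
  map_ι h := by rw [Equiv.eq_symm_apply, ← e.map_ι, Equiv.apply_symm_apply]

def Iso.trans {g g' g'' : OneGraph} (e : Iso g g') (f : Iso g' g'') : Iso g g'' where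
  eV := e.eV.trans f.eV
  eH := e.eH.trans f.eH
  map_ν h := by simp [f.map_ν, e.map_ν]
  map_ι h := by simp [f.map_ι, e.map_ι]

instance setoid : Setoid OneGraph where
  r g g' := Nonempty (Iso g g')
  iseqv := ⟨fun g => ⟨Iso.refl g⟩, fun ⟨e⟩ => ⟨e.symm⟩, fun ⟨e⟩ ⟨f⟩ => ⟨e.trans f⟩⟩

end OneGraph

/-- Unlabelled 1-graphs. -/
def UOneGraph : Type 1 := Quotient OneGraph.setoid

/-! ### 2-graphs -/

/-- A finite 2-graph: a graph `(V, H, ν, ι)` together with strand sections `S`, the adjacency map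
`μ`, the fixed-point free pairing `σ₁` of strand sections at the vertices, and the pairing `σ₂` of
strand sections along the edges. -/
structure TwoGraph where
  V : Type
  H : Type
  S : Type
  [finV : Finite V]
  [finH : Finite H]
  [finS : Finite S]
  ν : H → V
  ι : H → H
  ι_invol : Function.Involutive ι
  μ : S → H
  σ₁ : S → S
  σ₁_invol : Function.Involutive σ₁
  σ₁_ne : ∀ s, σ₁ s ≠ s
  ν_μ_σ₁ : ∀ s, ν (μ (σ₁ s)) = ν (μ s)
  σ₂ : S → S
  σ₂_invol : Function.Involutive σ₂
  ι_μ : ∀ s, ι (μ s) = μ (σ₂ s)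
  σ₂_fix_iff : ∀ s, σ₂ s = s ↔ ι (μ s) = μ s

attribute [instance] TwoGraph.finV TwoGraph.finH TwoGraph.finS

namespace TwoGraph

/-- Isomorphisms (relabellings) of 2-graphs. -/
structure Iso (G G' : TwoGraph) where
  eV : G.V ≃ G'.V
  eH : G.H ≃ G'.H
  eS : G.S ≃ G'.S
  map_ν : ∀ h, G'.ν (eH h) = eV (G.ν h)
  map_μ : ∀ s, G'.μ (eS s) = eH (G.μ s)
  map_ι : ∀ h, G'.ι (eH h) = eH (G.ι h)
  map_σ₁ : ∀ s, G'.σ₁ (eS s) = eS (G.σ₁ s)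
  map_σ₂ : ∀ s, G'.σ₂ (eS s) = eS (G.σ₂ s)

def Iso.refl (G : TwoGraph) : Iso G G :=
  ⟨Equiv.refl _, Equiv.refl _, Equiv.refl _, fun _ => rfl, fun _ => rfl, fun _ => rfl,
    fun _ => rfl, fun _ => rfl⟩

def Iso.symm {G G' : TwoGraph} (e : Iso G G') : Iso G' G where
  eV := e.eV.symm
  eH := e.eH.symm
  eS := e.eS.symm
  map_ν h := by rw [Equiv.eq_symm_apply, ← e.map_ν, Equiv.apply_symm_apply]
  map_μ h := by rw [Equiv.eq_symm_apply, ← e.map_μ, Equiv.apply_symm_apply]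
  map_ι h := by rw [Equiv.eq_symm_apply, ← e.map_ι, Equiv.apply_symm_apply]
  map_σ₁ h := by rw [Equiv.eq_symm_apply, ← e.map_σ₁, Equiv.apply_symm_apply]
  map_σ₂ h := by rw [Equiv.eq_symm_apply, ← e.map_σ₂, Equiv.apply_symm_apply]

def Iso.trans {G G' G'' : TwoGraph} (e : Iso G G') (f : Iso G' G'') : Iso G G'' where
  eV := e.eV.trans f.eV
  eH := e.eH.trans f.eH
  eS := e.eS.trans f.eS
  map_ν h := by simp [f.map_ν, e.map_ν]
  map_μ h := by simp [f.map_μ, e.map_μ]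
  map_ι h := by simp [f.map_ι, e.map_ι]
  map_σ₁ h := by simp [f.map_σ₁, e.map_σ₁]
  map_σ₂ h := by simp [f.map_σ₂, e.map_σ₂]

instance setoid : Setoid TwoGraph where
  r G G' := Nonempty (Iso G G')
  iseqv := ⟨fun G => ⟨Iso.refl G⟩, fun ⟨e⟩ => ⟨e.symm⟩, fun ⟨e⟩ ⟨f⟩ => ⟨e.trans f⟩⟩

/-- The vertex graph of a vertex `v`: half-edges at `v` become vertices, strand sections at `v`
become half-edges, and the pairing of the latter is `σ₁`. -/
def vertexGraph (G : TwoGraph) (v : G.V) : OneGraph where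
  V := {h : G.H // G.ν h = v}
  H := {s : G.S // G.ν (G.μ s) = v}
  ν s := ⟨G.μ s.1, s.2⟩
  ι s := ⟨G.σ₁ s.1, (G.ν_μ_σ₁ s.1).trans s.2⟩
  ι_invol s := Subtype.ext (G.σ₁_invol s.1)

/-- A residue is a 2-graph without (stranded) edges. -/
def IsResidue (G : TwoGraph) : Prop := ∀ h, G.ι h = h

/-- The empty 2-graph. -/
def empty : TwoGraph where
  V := Empty
  H := Empty
  S := Empty
  ν := id
  ι := id
  ι_invol := fun _ => rfl
  μ := id
  σ₁ := id
  σ₁_invol := fun _ => rfl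
  σ₁_ne := fun s => s.elim
  ν_μ_σ₁ := fun _ => rfl
  σ₂ := id
  σ₂_invol := fun _ => rfl
  ι_μ := fun _ => rfl
  σ₂_fix_iff := fun s => s.elim

/-- Disjoint union of 2-graphs. -/
def disjUnion (G G' : TwoGraph) : TwoGraph where
  V := G.V ⊕ G'.V
  H := G.H ⊕ G'.H
  S := G.S ⊕ G'.S
  ν := Sum.map G.ν G'.ν
  ι := Sum.map G.ι G'.ι
  ι_invol := by
    rintro (h | h)
    exacts [congrArg Sum.inl (G.ι_invol h), congrArg Sum.inr (G'.ι_invol h)]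
  μ := Sum.map G.μ G'.μ
  σ₁ := Sum.map G.σ₁ G'.σ₁
  σ₁_invol := by
    rintro (s | s)
    exacts [congrArg Sum.inl (G.σ₁_invol s), congrArg Sum.inr (G'.σ₁_invol s)]
  σ₁_ne := by rintro (s | s) <;> simp [G.σ₁_ne, G'.σ₁_ne]
  ν_μ_σ₁ := by rintro (s | s) <;> simp [G.ν_μ_σ₁, G'.ν_μ_σ₁]
  σ₂ := Sum.map G.σ₂ G'.σ₂
  σ₂_invol := by
    rintro (s | s)
    exacts [congrArg Sum.inl (G.σ₂_invol s), congrArg Sum.inr (G'.σ₂_invol s)]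
  ι_μ := by rintro (s | s) <;> simp [G.ι_μ, G'.ι_μ]
  σ₂_fix_iff := by rintro (s | s) <;> simp [G.σ₂_fix_iff, G'.σ₂_fix_iff]

def Iso.disjUnion {G₁ G₂ G₁' G₂' : TwoGraph} (e : Iso G₁ G₁') (f : Iso G₂ G₂') :
    Iso (G₁.disjUnion G₂) (G₁'.disjUnion G₂') where
  eV := Equiv.sumCongr e.eV f.eV
  eH := Equiv.sumCongr e.eH f.eH
  eS := Equiv.sumCongr e.eS f.eS
  map_ν := by
    rintro (h | h)
    exacts [congrArg Sum.inl (e.map_ν h), congrArg Sum.inr (f.map_ν h)]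
  map_μ := by
    rintro (h | h)
    exacts [congrArg Sum.inl (e.map_μ h), congrArg Sum.inr (f.map_μ h)]
  map_ι := by
    rintro (h | h)
    exacts [congrArg Sum.inl (e.map_ι h), congrArg Sum.inr (f.map_ι h)]
  map_σ₁ := by
    rintro (h | h)
    exacts [congrArg Sum.inl (e.map_σ₁ h), congrArg Sum.inr (f.map_σ₁ h)]
  map_σ₂ := by
    rintro (h | h)
    exacts [congrArg Sum.inl (e.map_σ₂ h), congrArg Sum.inr (f.map_σ₂ h)]

def Iso.assoc (G₁ G₂ G₃ : TwoGraph) :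
    Iso ((G₁.disjUnion G₂).disjUnion G₃) (G₁.disjUnion (G₂.disjUnion G₃)) where
  eV := Equiv.sumAssoc _ _ _
  eH := Equiv.sumAssoc _ _ _
  eS := Equiv.sumAssoc _ _ _
  map_ν := by rintro ((h | h) | h) <;> rfl
  map_μ := by rintro ((h | h) | h) <;> rfl
  map_ι := by rintro ((h | h) | h) <;> rfl
  map_σ₁ := by rintro ((h | h) | h) <;> rfl
  map_σ₂ := by rintro ((h | h) | h) <;> rfl

def Iso.comm (G₁ G₂ : TwoGraph) : Iso (G₁.disjUnion G₂) (G₂.disjUnion G₁) where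
  eV := Equiv.sumComm _ _
  eH := Equiv.sumComm _ _
  eS := Equiv.sumComm _ _
  map_ν := by rintro (h | h) <;> rfl
  map_μ := by rintro (h | h) <;> rfl
  map_ι := by rintro (h | h) <;> rfl
  map_σ₁ := by rintro (h | h) <;> rfl
  map_σ₂ := by rintro (h | h) <;> rfl

def Iso.emptyUnion (G : TwoGraph) : Iso (empty.disjUnion G) G where
  eV := Equiv.emptySum Empty _
  eH := Equiv.emptySum Empty _
  eS := Equiv.emptySum Empty _
  map_ν := by rintro (h | h); exacts [h.elim, rfl]
  map_μ := by rintro (h | h); exacts [h.elim, rfl]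
  map_ι := by rintro (h | h); exacts [h.elim, rfl]
  map_σ₁ := by rintro (h | h); exacts [h.elim, rfl]
  map_σ₂ := by rintro (h | h); exacts [h.elim, rfl]

/-! ### Subgraphs and contraction -/

/-- A subgraph of a 2-graph `G` differs from `G` only in having fewer (stranded) edges. It is given
by its set of edges, recorded as the set of the half-edges contained in them; the paired strand
sections are then exactly those adjacent to these half-edges. -/
@[ext] structure Subgraph (G : TwoGraph) where
  carrier : Set G.H
  ι_mem : ∀ h ∈ carrier, G.ι h ∈ carrier
  ι_ne : ∀ h ∈ carrier, G.ι h ≠ h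

namespace Subgraph

variable {G : TwoGraph} (K : G.Subgraph)

instance : Finite G.Subgraph :=
  Finite.of_injective (fun K : G.Subgraph => K.carrier) fun _ _ h => Subgraph.ext h

instance : Fintype G.Subgraph := Fintype.ofFinite _

theorem ι_mem_iff (h : G.H) : G.ι h ∈ K.carrier ↔ h ∈ K.carrier :=
  ⟨fun hh => by simpa [G.ι_invol h] using K.ι_mem _ hh, K.ι_mem h⟩

theorem σ₂_mem_iff (s : G.S) : G.μ (G.σ₂ s) ∈ K.carrier ↔ G.μ s ∈ K.carrier := by
  rw [← G.ι_μ, K.ι_mem_iff]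

open Classical in
/-- The involution on half-edges of the subgraph. -/
def edgeMap (h : G.H) : G.H := if h ∈ K.carrier then G.ι h else h

open Classical in
/-- The pairing of strand sections along the edges of the subgraph. -/
def strandMap (s : G.S) : G.S := if G.μ s ∈ K.carrier then G.σ₂ s else s

theorem strandMap_invol : Function.Involutive K.strandMap := by
  intro s
  by_cases hs : G.μ s ∈ K.carrier
  · simp [strandMap, hs, K.σ₂_mem_iff, G.σ₂_invol s]
  · simp [strandMap, hs]

theorem strandMap_mem_iff (s : G.S) : G.μ (K.strandMap s) ∈ K.carrier ↔ G.μ s ∈ K.carrier := by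
  by_cases hs : G.μ s ∈ K.carrier
  · simp [strandMap, hs, K.σ₂_mem_iff]
  · simp [strandMap, hs]

theorem strandMap_fix_iff (s : G.S) : K.strandMap s = s ↔ G.μ s ∉ K.carrier := by
  by_cases hs : G.μ s ∈ K.carrier
  · simp [strandMap, hs, G.σ₂_fix_iff, K.ι_ne]
  · simp [strandMap, hs]

/-- The subgraph as a 2-graph. -/
def toTwoGraph : TwoGraph where
  V := G.V
  H := G.H
  S := G.S
  ν := G.ν
  ι := K.edgeMap
  ι_invol h := by
    by_cases hh : h ∈ K.carrier
    · simp [edgeMap, hh, K.ι_mem_iff, G.ι_invol h]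
    · simp [edgeMap, hh]
  μ := G.μ
  σ₁ := G.σ₁
  σ₁_invol := G.σ₁_invol
  σ₁_ne := G.σ₁_ne
  ν_μ_σ₁ := G.ν_μ_σ₁
  σ₂ := K.strandMap
  σ₂_invol := K.strandMap_invol
  ι_μ s := by
    by_cases hs : G.μ s ∈ K.carrier
    · simp [edgeMap, strandMap, hs, G.ι_μ]
    · simp [edgeMap, strandMap, hs]
  σ₂_fix_iff s := by
    rw [K.strandMap_fix_iff]
    by_cases hs : G.μ s ∈ K.carrier
    · simp [edgeMap, hs, K.ι_ne]
    · simp [edgeMap, hs]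

/-- Two vertices are linked if an edge of the subgraph joins them. -/
def Link (v w : G.V) : Prop := ∃ h ∈ K.carrier, G.ν h = v ∧ G.ν (G.ι h) = w

/-- The connected components of the subgraph: the quotient of the set of vertices by the
equivalence relation generated by `Link`. -/
def Comp : Type := Quot K.Link

instance : Finite K.Comp := inferInstanceAs (Finite (Quot K.Link))

/-- The component of the subgraph that contains a given vertex. -/
def comp (v : G.V) : K.Comp := Quot.mk _ v

/-- The strand section reached from `s` after `2 * k + 1` steps of the alternating chain
`s, σ₁ s, σ₂ (σ₁ s), …` of strand sections in the subgraph. -/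
def chain (s : G.S) (k : ℕ) : G.S := G.σ₁ ((fun t => K.strandMap (G.σ₁ t))^[k] s)

/-- A chain that starts at an external strand section of the subgraph reaches another one. -/
theorem exists_chain (s : G.S) (hs : G.μ s ∉ K.carrier) :
    ∃ k, G.μ (K.chain s k) ∉ K.carrier := by
  have hinj : Function.Injective (fun t => K.strandMap (G.σ₁ t)) :=
    K.strandMap_invol.injective.comp G.σ₁_invol.injective
  obtain ⟨n, hn, hp⟩ := hinj.mem_periodicPts s
  obtain ⟨m, rfl⟩ := Nat.exists_eq_succ_of_ne_zero hn.ne'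
  refine ⟨m, ?_⟩
  have h1 : K.strandMap (K.chain s m) = s := by
    have := hp
    rw [Function.IsPeriodicPt, Function.IsFixedPt, Function.iterate_succ_apply'] at this
    exact this
  rw [← K.strandMap_mem_iff, h1]
  exact hs

open Classical in
/-- The number of times the external face of the subgraph starting at `s` passes along an edge. -/
def faceLength (s : G.S) (hs : G.μ s ∉ K.carrier) : ℕ := Nat.find (K.exists_chain s hs)

/-- The last strand section of the external face of the subgraph that starts at `s`. -/
def faceEnd (s : G.S) (hs : G.μ s ∉ K.carrier) : G.S := K.chain s (K.faceLength s hs)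

theorem faceEnd_ext (s : G.S) (hs : G.μ s ∉ K.carrier) : G.μ (K.faceEnd s hs) ∉ K.carrier := by
  classical
  exact Nat.find_spec (K.exists_chain s hs)

theorem chain_mem (s : G.S) (hs : G.μ s ∉ K.carrier) (j : ℕ) (hj : j < K.faceLength s hs) :
    G.μ (K.chain s j) ∈ K.carrier := by
  classical
  exact not_not.mp (Nat.find_min (K.exists_chain s hs) hj)

theorem comp_strandMap (s : G.S) : K.comp (G.ν (G.μ (K.strandMap s))) = K.comp (G.ν (G.μ s)) := by
  by_cases hs : G.μ s ∈ K.carrier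
  · refine (Quot.sound ⟨G.μ s, hs, rfl, ?_⟩).symm
    simp [strandMap, hs, G.ι_μ]
  · simp [strandMap, hs]

theorem comp_chain (s : G.S) (k : ℕ) : K.comp (G.ν (G.μ (K.chain s k))) = K.comp (G.ν (G.μ s)) := by
  rw [chain, G.ν_μ_σ₁]
  induction k with
  | zero => rfl
  | succ k ih => rw [Function.iterate_succ_apply', K.comp_strandMap, G.ν_μ_σ₁, ih]

theorem iterate_chain (s : G.S) (k j : ℕ) (hj : j ≤ k) :
    (fun t => K.strandMap (G.σ₁ t))^[j] (K.chain s k) = K.chain s (k - j) := by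
  induction j with
  | zero => rfl
  | succ j ih =>
    rw [Function.iterate_succ_apply', ih (by omega)]
    obtain ⟨m, hm⟩ : ∃ m, k - j = m + 1 := ⟨k - j - 1, by omega⟩
    have hm2 : k - (j + 1) = m := by omega
    rw [hm, hm2, chain, G.σ₁_invol, Function.iterate_succ_apply', K.strandMap_invol, chain]

theorem chain_chain (s : G.S) (k j : ℕ) (hj : j ≤ k) :
    K.chain (K.chain s k) j = (fun t => K.strandMap (G.σ₁ t))^[k - j] s := by
  rw [chain, K.iterate_chain s k j hj, chain, G.σ₁_invol]

theorem faceEnd_faceEnd (s : G.S) (hs : G.μ s ∉ K.carrier) :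
    K.faceEnd (K.faceEnd s hs) (K.faceEnd_ext s hs) = s := by
  classical
  have hl : K.faceLength (K.faceEnd s hs) (K.faceEnd_ext s hs) = K.faceLength s hs := by
    refine (Nat.find_eq_iff _).mpr ⟨?_, fun j hj => ?_⟩
    · rw [faceEnd, K.chain_chain _ _ _ le_rfl]
      simpa using hs
    · rw [not_not, faceEnd, K.chain_chain _ _ _ hj.le]
      obtain ⟨m, hm⟩ : ∃ m, K.faceLength s hs - j = m + 1 := ⟨K.faceLength s hs - j - 1, by omega⟩
      rw [hm, Function.iterate_succ_apply', K.strandMap_mem_iff]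
      exact K.chain_mem s hs m (by omega)
  rw [faceEnd, hl, faceEnd, K.chain_chain _ _ _ le_rfl]
  simp

theorem faceEnd_ne (s : G.S) (hs : G.μ s ∉ K.carrier) : K.faceEnd s hs ≠ s := by
  intro h
  set k := K.faceLength s hs with hk
  have hc : K.chain s k = s := h
  obtain ⟨m, hm | hm⟩ := k.even_or_odd'
  · have h1 := K.iterate_chain s k m (by omega)
    rw [hc, show k - m = m by omega, chain] at h1
    exact G.σ₁_ne _ h1.symm
  · have h1 := K.iterate_chain s k (m + 1) (by omega)
    rw [hc, show k - (m + 1) = m by omega, Function.iterate_succ_apply'] at h1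
    exact (K.strandMap_fix_iff _).mp h1 (K.chain_mem s hs m (by omega))

/-- The contraction `G / K`: each component of `K` becomes a vertex, only the half-edges and strand
sections external in `K` remain, the stranded edges of `K` are deleted, and each external face of
`K` is shrunk to the pair of its two end strand sections. -/
def contract : TwoGraph where
  V := K.Comp
  H := {h : G.H // h ∉ K.carrier}
  S := {s : G.S // G.μ s ∉ K.carrier}
  ν h := K.comp (G.ν h.1)
  ι h := ⟨G.ι h.1, fun hh => h.2 ((K.ι_mem_iff _).mp hh)⟩
  ι_invol h := Subtype.ext (G.ι_invol h.1)
  μ s := ⟨G.μ s.1, s.2⟩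
  σ₁ s := ⟨K.faceEnd s.1 s.2, K.faceEnd_ext s.1 s.2⟩
  σ₁_invol s := Subtype.ext (K.faceEnd_faceEnd s.1 s.2)
  σ₁_ne s h := K.faceEnd_ne s.1 s.2 (Subtype.ext_iff.mp h)
  ν_μ_σ₁ s := K.comp_chain s.1 _
  σ₂ s := ⟨G.σ₂ s.1, fun hh => s.2 ((K.σ₂_mem_iff _).mp hh)⟩
  σ₂_invol s := Subtype.ext (G.σ₂_invol s.1)
  ι_μ s := Subtype.ext (G.ι_μ s.1)
  σ₂_fix_iff s := by simpa [Subtype.ext_iff] using G.σ₂_fix_iff s.1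

end Subgraph

end TwoGraph

/-! ### Unlabelled 2-graphs -/

/-- Unlabelled 2-graphs: isomorphism classes of 2-graphs. -/
def UTwoGraph : Type 1 := Quotient TwoGraph.setoid

namespace UTwoGraph

/-- The isomorphism class of a 2-graph. -/
def mk (G : TwoGraph) : UTwoGraph := Quotient.mk TwoGraph.setoid G

/-- Unlabelled 2-graphs form a commutative monoid under disjoint union. -/
instance : CommMonoid UTwoGraph where
  mul := Quotient.map₂ TwoGraph.disjUnion fun _ _ ⟨e⟩ _ _ ⟨f⟩ => ⟨e.disjUnion f⟩
  one := mk TwoGraph.empty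
  mul_assoc := by
    rintro ⟨a⟩ ⟨b⟩ ⟨c⟩
    exact Quotient.sound ⟨TwoGraph.Iso.assoc a b c⟩
  mul_comm := by
    rintro ⟨a⟩ ⟨b⟩
    exact Quotient.sound ⟨TwoGraph.Iso.comm a b⟩
  one_mul := by
    rintro ⟨a⟩
    exact Quotient.sound ⟨TwoGraph.Iso.emptyUnion a⟩
  mul_one := by
    rintro ⟨a⟩
    exact Quotient.sound ⟨(TwoGraph.Iso.comm a _).trans (TwoGraph.Iso.emptyUnion a)⟩

/-- The submonoid of (unlabelled) residues. -/
def residues : Submonoid UTwoGraph where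
  carrier := {Γ | ∃ G : TwoGraph, G.IsResidue ∧ mk G = Γ}
  one_mem' := ⟨TwoGraph.empty, fun h => h.elim, rfl⟩
  mul_mem' := by
    rintro _ _ ⟨G, hG, rfl⟩ ⟨G', hG', rfl⟩
    refine ⟨G.disjUnion G', ?_, rfl⟩
    rintro (h | h)
    · exact congrArg Sum.inl (hG h)
    · exact congrArg Sum.inr (hG' h)

/-- The 2-graphs all of whose vertex graphs are of a type in `𝒱`. -/
def ofVertexTypes (𝒱 : Set UOneGraph) : Set UTwoGraph :=
  {Γ | ∃ G : TwoGraph, (∀ v, Quotient.mk OneGraph.setoid (G.vertexGraph v) ∈ 𝒱) ∧ mk G = Γ}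

/-- The contraction closure of a set of 2-graphs: all contractions of its elements. -/
def contractionClosure (𝒦 : Set UTwoGraph) : Set UTwoGraph :=
  {Γ | ∃ (G : TwoGraph) (K : G.Subgraph), mk G ∈ 𝒦 ∧ mk K.contract = Γ}

end UTwoGraph

/-! ### The algebra of 2-graphs -/

/-- The `ℚ`-algebra of 2-graphs: it has the unlabelled 2-graphs as a basis, and the product is
induced by disjoint union. -/
abbrev TwoGraphAlgebra : Type 1 := MonoidAlgebra ℚ UTwoGraph

/-- The algebra of 2-graphs, augmented by formal inverses of all residues. -/
abbrev AugTwoGraphAlgebra : Type 1 :=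
  Localization (UTwoGraph.residues.map (MonoidAlgebra.of ℚ UTwoGraph))

/-- An unlabelled 2-graph as an element of the augmented algebra. -/
def UTwoGraph.gen (Γ : UTwoGraph) : AugTwoGraphAlgebra :=
  algebraMap TwoGraphAlgebra AugTwoGraphAlgebra (MonoidAlgebra.of ℚ UTwoGraph Γ)

/-- A (labelled) 2-graph as an element of the augmented algebra. -/
def TwoGraph.gen (G : TwoGraph) : AugTwoGraphAlgebra := (UTwoGraph.mk G).gen

/-- The convolution product of two linear maps with respect to a coproduct `Δ`. -/
def convolution {C A : Type*} [AddCommMonoid C] [Module ℚ C] [CommRing A] [Algebra ℚ A]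
    (Δ : C →ₗ[ℚ] C ⊗[ℚ] C) (f g : C →ₗ[ℚ] A) : C →ₗ[ℚ] A :=
  LinearMap.mul' ℚ A ∘ₗ TensorProduct.map f g ∘ₗ Δ

/-- A subalgebra `B` is a subbialgebra if the coproduct maps it to `B ⊗ B`. -/
def IsSubbialgebra {C : Type*} [CommRing C] [Algebra ℚ C] (Δ : C →ₗ[ℚ] C ⊗[ℚ] C)
    (B : Subalgebra ℚ C) : Prop :=
  ∀ x ∈ B, Δ x ∈ (Algebra.TensorProduct.map B.val B.val).range

/-- The subalgebra generated by a set of 2-graphs. -/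
def graphSubalgebra (𝒦 : Set UTwoGraph) : Subalgebra ℚ AugTwoGraphAlgebra :=
  Algebra.adjoin ℚ (UTwoGraph.gen '' 𝒦)

/-- The subalgebra generated by a set of 2-graphs and the formal inverses of the residues in it. -/
def augGraphSubalgebra (𝒦 : Set UTwoGraph) : Subalgebra ℚ AugTwoGraphAlgebra :=
  Algebra.adjoin ℚ (UTwoGraph.gen '' 𝒦 ∪
    {x | ∃ ρ ∈ 𝒦, ρ ∈ UTwoGraph.residues ∧ x * ρ.gen = 1})

end

/-! Coassociativity reduces to sums over flags `L ≤ K` of subgraphs of `G`. Subgraphs of `K` are the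
subgraphs of `G` below `K`, and subgraphs of `G / L` correspond to those above `L`. Moreover `K / L`
is the same graph whether formed inside `K` or inside `G / L`, and `(G / L) / (K / L) ≅ G / K`.
Hence both iterated coproducts equal the sum of `L ⊗ K / L ⊗ G / K`. The delicate point is `σ₁` of a
contraction, which is given by external faces: a face of `K` is a concatenation of faces of `L`
joined along edges of `K` outside `L`. Describing faces by an inductive relation (`Face`) makes this
an induction (`Face.trans`, `Face.of_quot`).

Only the edgeless subgraph is a residue and only the full subgraph has a residue as contraction,
which gives the two counit laws. Compatibility with disjoint union gives multiplicativity, and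
residues are group-like, so the maps extend to the localization.

The bialgebra is not connected, since every residue is group-like. Still, in the equation `ψ * φ =
ε` for an algebra homomorphism `φ`, the term of the full subgraph is `ψ(G) φ(r)` with `r` the
residue of `G`. As `r` is invertible, the equation can be solved for `ψ(G)` by recursion on the
number of edges (`convInv`). The solution is again multiplicative (`convInv_disjUnion`). This yields
the antipode and all convolution inverses, and the same recursion shows that the antipode preserves
subalgebras generated by families closed under subgraphs and contractions, once the inverses of
their residues are adjoined. -/

noncomputable section

namespace TwoGraph

namespace Subgraph

variable {G G' : TwoGraph}

/-! ### External faces as a relation -/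

/-- `K.Face s t` means that the alternating chain of `K` starting with `s`, `σ₁ s` has `t` as its
first external strand section. -/
inductive Face (K : G.Subgraph) : G.S → G.S → Prop
  | last (s : G.S) (h : G.μ (G.σ₁ s) ∉ K.carrier) : Face K s (G.σ₁ s)
  | step {s t : G.S} (h : G.μ (G.σ₁ s) ∈ K.carrier) (ht : Face K (G.σ₂ (G.σ₁ s)) t) : Face K s t

/-- The two constructors have complementary hypotheses, so the chain is deterministic. -/
theorem Face.unique {K : G.Subgraph} {s t t' : G.S} (h : K.Face s t) (h' : K.Face s t') :
    t = t' := by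
  induction h with
  | last s hs => cases h' with
    | last => rfl
    | step h _ => exact absurd h hs
  | step hs _ ih => cases h' with
    | last _ h => exact absurd hs h
    | step _ h => exact ih h

theorem chain_succ (K : G.Subgraph) (s : G.S) (k : ℕ) :
    K.chain s (k + 1) = K.chain (K.strandMap (G.σ₁ s)) k := by
  rw [chain, Function.iterate_succ_apply, chain]

theorem face_chain (K : G.Subgraph) (k : ℕ) : ∀ s : G.S,
    (∀ j < k, G.μ (K.chain s j) ∈ K.carrier) → G.μ (K.chain s k) ∉ K.carrier →
      K.Face s (K.chain s k) := by
  induction k with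
  | zero => exact fun s _ h => Face.last s h
  | succ k ih =>
    intro s h1 h2
    have h0 : G.μ (G.σ₁ s) ∈ K.carrier := h1 0 k.succ_pos
    have hs : K.strandMap (G.σ₁ s) = G.σ₂ (G.σ₁ s) := if_pos h0
    rw [K.chain_succ, hs] at h2 ⊢
    refine Face.step h0 (ih _ (fun j hj => ?_) h2)
    rw [← hs, ← K.chain_succ]
    exact h1 _ (by omega)

theorem face_faceEnd (K : G.Subgraph) (s : G.S) (hs : G.μ s ∉ K.carrier) :
    K.Face s (K.faceEnd s hs) :=
  K.face_chain _ s (K.chain_mem s hs) (K.faceEnd_ext s hs)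

/-- Reduces every identity about `σ₁` of a contraction to exhibiting a chain, without computing face
lengths. -/
theorem Face.faceEnd_eq {K : G.Subgraph} {s t : G.S} (h : K.Face s t) (hs : G.μ s ∉ K.carrier) :
    K.faceEnd s hs = t :=
  (K.face_faceEnd s hs).unique h

/-- Compatibility with `σ₂` is required only along edges of `K`: a chain never crosses any other
edge. This allows the ambient graphs to differ outside `K`, as for `K.toTwoGraph` and `G`. -/
theorem Face.map {K : G.Subgraph} {K' : G'.Subgraph} (f : G.S → G'.S)
    (h₁ : ∀ s, G'.σ₁ (f s) = f (G.σ₁ s))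
    (hK : ∀ s, G'.μ (f s) ∈ K'.carrier ↔ G.μ s ∈ K.carrier)
    (h₂ : ∀ s, G.μ s ∈ K.carrier → G'.σ₂ (f s) = f (G.σ₂ s))
    {s t : G.S} (h : K.Face s t) : K'.Face (f s) (f t) := by
  induction h with
  | last s hs => rw [← h₁]; exact Face.last _ (by rwa [h₁, hK])
  | step hs _ ih =>
    refine Face.step (by rwa [h₁, hK]) ?_
    rwa [h₁, h₂ _ hs]

/-! ### Subgraphs of isomorphic graphs -/

theorem toTwoGraph_ι_of_mem {K : G.Subgraph} {h : G.H} (hh : h ∈ K.carrier) :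
    K.toTwoGraph.ι h = G.ι h := if_pos hh

theorem toTwoGraph_ι_of_notMem {K : G.Subgraph} {h : G.H} (hh : h ∉ K.carrier) :
    K.toTwoGraph.ι h = h := if_neg hh

theorem toTwoGraph_σ₂_of_mem {K : G.Subgraph} {s : G.S} (hs : G.μ s ∈ K.carrier) :
    K.toTwoGraph.σ₂ s = G.σ₂ s := if_pos hs

theorem toTwoGraph_σ₂_of_notMem {K : G.Subgraph} {s : G.S} (hs : G.μ s ∉ K.carrier) :
    K.toTwoGraph.σ₂ s = s := if_neg hs

/-- The image of a subgraph under an isomorphism. -/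
def map (e : Iso G G') (K : G.Subgraph) : G'.Subgraph where
  carrier := {h | e.eH.symm h ∈ K.carrier}
  ι_mem h hh := by
    have h' : G.ι (e.eH.symm h) = e.eH.symm (G'.ι h) := e.symm.map_ι h
    exact Set.mem_ofPred.mpr (h' ▸ K.ι_mem _ hh)
  ι_ne h hh := by
    have := K.ι_ne _ hh
    exact fun h' => this ((e.symm.map_ι h).trans (congrArg _ h'))

theorem mem_map (e : Iso G G') (K : G.Subgraph) (h : G.H) :
    e.eH h ∈ (K.map e).carrier ↔ h ∈ K.carrier := by
  simp [map]

/-- Isomorphic graphs have the same subgraphs. -/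
def mapEquiv (e : Iso G G') : G.Subgraph ≃ G'.Subgraph where
  toFun := map e
  invFun := map e.symm
  left_inv K := by ext h; simp [map, Iso.symm]
  right_inv K := by ext h; simp [map, Iso.symm]

/-- An isomorphism of graphs that identifies two subgraphs. -/
def isoToTwoGraph (e : Iso G G') (K : G.Subgraph) (K' : G'.Subgraph)
    (hK : ∀ h, e.eH h ∈ K'.carrier ↔ h ∈ K.carrier) : Iso K.toTwoGraph K'.toTwoGraph where
  eV := e.eV
  eH := e.eH
  eS := e.eS
  map_ν := e.map_ν
  map_μ := e.map_μ
  map_ι h := by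
    by_cases hh : h ∈ K.carrier
    · exact (toTwoGraph_ι_of_mem ((hK h).mpr hh)).trans <|
        (e.map_ι h).trans <| congrArg e.eH (toTwoGraph_ι_of_mem hh).symm
    · exact (toTwoGraph_ι_of_notMem (mt (hK h).mp hh)).trans <|
        congrArg e.eH (toTwoGraph_ι_of_notMem hh).symm
  map_σ₁ := e.map_σ₁
  map_σ₂ s := by
    have hs : G'.μ (e.eS s) ∈ K'.carrier ↔ G.μ s ∈ K.carrier := (e.map_μ s).symm ▸ hK _
    by_cases hh : G.μ s ∈ K.carrier
    · exact (toTwoGraph_σ₂_of_mem (hs.mpr hh)).trans <|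
        (e.map_σ₂ s).trans <| congrArg e.eS (toTwoGraph_σ₂_of_mem hh).symm
    · exact (toTwoGraph_σ₂_of_notMem (mt hs.mp hh)).trans <|
        congrArg e.eS (toTwoGraph_σ₂_of_notMem hh).symm

/-- An isomorphism of graphs that identifies two subgraphs descends to the contractions. -/
def isoContract (e : Iso G G') (K : G.Subgraph) (K' : G'.Subgraph)
    (hK : ∀ h, e.eH h ∈ K'.carrier ↔ h ∈ K.carrier) : Iso K.contract K'.contract where
  eV := Quot.congr e.eV fun a b => by
    constructor
    · rintro ⟨h, hh, rfl, rfl⟩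
      exact ⟨e.eH h, (hK h).mpr hh, e.map_ν h, by rw [e.map_ι, e.map_ν]⟩
    · rintro ⟨h, hh, h1, h2⟩
      obtain ⟨h, rfl⟩ := e.eH.surjective h
      rw [e.map_ν, e.eV.apply_eq_iff_eq] at h1
      rw [e.map_ι, e.map_ν, e.eV.apply_eq_iff_eq] at h2
      exact ⟨h, (hK h).mp hh, h1, h2⟩
  eH := e.eH.subtypeEquiv fun h => not_congr (hK h).symm
  eS := e.eS.subtypeEquiv fun s => by rw [e.map_μ]; exact not_congr (hK _).symm
  map_ν h := congrArg K'.comp (e.map_ν h.1)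
  map_μ s := Subtype.ext (e.map_μ s.1)
  map_ι h := Subtype.ext (e.map_ι h.1)
  map_σ₁ s := Subtype.ext <|
    ((K.face_faceEnd s.1 s.2).map e.eS e.map_σ₁ (fun s => by rw [e.map_μ, hK])
      fun s _ => e.map_σ₂ s).faceEnd_eq _
  map_σ₂ s := Subtype.ext (e.map_σ₂ s.1)

/-! ### Subgraphs of disjoint unions -/

/-- The disjoint union of two subgraphs. -/
def sum (K : G.Subgraph) (K' : G'.Subgraph) : (G.disjUnion G').Subgraph where
  carrier := {h | Sum.elim (· ∈ K.carrier) (· ∈ K'.carrier) h}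
  ι_mem := by
    rintro (h | h) hh
    exacts [K.ι_mem h hh, K'.ι_mem h hh]
  ι_ne := by
    rintro (h | h) hh
    exacts [fun h' => K.ι_ne h hh (Sum.inl_injective h'),
      fun h' => K'.ι_ne h hh (Sum.inr_injective h')]

/-- A subgraph of a disjoint union is a disjoint union of subgraphs. -/
def sumEquiv (G G' : TwoGraph) : G.Subgraph × G'.Subgraph ≃ (G.disjUnion G').Subgraph where
  toFun p := p.1.sum p.2
  invFun K :=
    ({ carrier := {h | Sum.inl h ∈ K.carrier}
       ι_mem := fun h hh => K.ι_mem (Sum.inl h) hh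
       ι_ne := fun h hh h' => K.ι_ne (Sum.inl h) hh (congrArg Sum.inl h') },
     { carrier := {h | Sum.inr h ∈ K.carrier}
       ι_mem := fun h hh => K.ι_mem (Sum.inr h) hh
       ι_ne := fun h hh h' => K.ι_ne (Sum.inr h) hh (congrArg Sum.inr h') })
  left_inv p := rfl
  right_inv K := by ext (h | h) <;> rfl

def isoSumToTwoGraph (K : G.Subgraph) (K' : G'.Subgraph) :
    Iso (K.sum K').toTwoGraph (K.toTwoGraph.disjUnion K'.toTwoGraph) where
  eV := Equiv.refl _
  eH := Equiv.refl _
  eS := Equiv.refl _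
  map_ν _ := rfl
  map_μ _ := rfl
  map_ι := by
    rintro (h | h)
    · exact (@apply_ite _ _ Sum.inl _ (Classical.propDecidable _) _ _)
    · exact (@apply_ite _ _ Sum.inr _ (Classical.propDecidable _) _ _)
  map_σ₁ _ := rfl
  map_σ₂ := by
    rintro (h | h)
    · exact (@apply_ite _ _ Sum.inl _ (Classical.propDecidable _) _ _)
    · exact (@apply_ite _ _ Sum.inr _ (Classical.propDecidable _) _ _)

/-- The components of a disjoint union. -/
def compSumEquiv (K : G.Subgraph) (K' : G'.Subgraph) : (K.sum K').Comp ≃ K.Comp ⊕ K'.Comp where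
  toFun := Quot.lift (Sum.map K.comp K'.comp) <| by
    rintro _ _ ⟨h | h, hh, rfl, rfl⟩
    · exact congrArg Sum.inl (Quot.sound ⟨h, hh, rfl, rfl⟩)
    · exact congrArg Sum.inr (Quot.sound ⟨h, hh, rfl, rfl⟩)
  invFun := Sum.elim
    (Quot.lift (fun v => (K.sum K').comp (Sum.inl v)) <| by
      rintro _ _ ⟨h, hh, rfl, rfl⟩
      exact Quot.sound ⟨Sum.inl h, hh, rfl, rfl⟩)
    (Quot.lift (fun v => (K.sum K').comp (Sum.inr v)) <| by
      rintro _ _ ⟨h, hh, rfl, rfl⟩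
      exact Quot.sound ⟨Sum.inr h, hh, rfl, rfl⟩)
  left_inv := by rintro ⟨v | v⟩ <;> rfl
  right_inv := by
    rintro (v | v)
    · induction v using Quot.ind; rfl
    · induction v using Quot.ind; rfl

def isoSumContract (K : G.Subgraph) (K' : G'.Subgraph) :
    Iso (K.contract.disjUnion K'.contract) (K.sum K').contract where
  eV := (compSumEquiv K K').symm
  eH := (Equiv.subtypeSum (p := fun h => h ∉ (K.sum K').carrier)).symm
  eS := (Equiv.subtypeSum (p := fun s => (G.disjUnion G').μ s ∉ (K.sum K').carrier)).symm
  map_ν := by rintro (h | h) <;> rfl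
  map_μ := by rintro (s | s) <;> rfl
  map_ι := by rintro (h | h) <;> rfl
  map_σ₁ := by
    rintro (s | s)
    · exact Subtype.ext <| ((K.face_faceEnd s.1 s.2).map (K' := K.sum K') Sum.inl
        (fun _ => rfl) (fun _ => Iff.rfl) fun _ _ => rfl).faceEnd_eq _
    · exact Subtype.ext <| ((K'.face_faceEnd s.1 s.2).map (K' := K.sum K') Sum.inr
        (fun _ => rfl) (fun _ => Iff.rfl) fun _ _ => rfl).faceEnd_eq _
  map_σ₂ := by rintro (s | s) <;> rfl

/-! ### The order on subgraphs -/

instance : PartialOrder G.Subgraph :=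
  PartialOrder.lift carrier fun _ _ h => Subgraph.ext h

instance : BoundedOrder G.Subgraph where
  bot := ⟨∅, fun _ h => h.elim, fun _ h => h.elim⟩
  bot_le _ := Set.empty_subset _
  top := ⟨{h | G.ι h ≠ h}, fun h hh => by simpa [G.ι_invol h] using hh.symm, fun _ hh => hh⟩
  le_top K := K.ι_ne

theorem not_mem_bot {h : G.H} : h ∉ (⊥ : G.Subgraph).carrier := fun h => h

def isoTop (G : TwoGraph) : Iso (⊤ : G.Subgraph).toTwoGraph G where
  eV := Equiv.refl _
  eH := Equiv.refl _
  eS := Equiv.refl _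
  map_ν _ := rfl
  map_μ _ := rfl
  map_ι h := by
    by_cases hh : h ∈ (⊤ : G.Subgraph).carrier
    · exact (toTwoGraph_ι_of_mem hh).symm
    · exact (not_not.mp hh).trans (toTwoGraph_ι_of_notMem hh).symm
  map_σ₁ _ := rfl
  map_σ₂ s := by
    by_cases hh : G.μ s ∈ (⊤ : G.Subgraph).carrier
    · exact (toTwoGraph_σ₂_of_mem hh).symm
    · exact ((G.σ₂_fix_iff s).mpr (not_not.mp hh)).trans (toTwoGraph_σ₂_of_notMem hh).symm

def isoBot (G : TwoGraph) : Iso G (⊥ : G.Subgraph).contract where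
  eV :=
    { toFun := (⊥ : G.Subgraph).comp
      invFun := Quot.lift id fun _ _ ⟨_, hh, _⟩ => hh.elim
      left_inv := fun _ => rfl
      right_inv := by rintro ⟨v⟩; rfl }
  eH := (Equiv.subtypeUnivEquiv fun _ => not_mem_bot).symm
  eS := (Equiv.subtypeUnivEquiv fun _ => not_mem_bot).symm
  map_ν _ := rfl
  map_μ _ := rfl
  map_ι _ := rfl
  map_σ₁ s := Subtype.ext <| (Face.last (K := ⊥) s not_mem_bot).faceEnd_eq _
  map_σ₂ _ := rfl

/-- Together with `isResidue_contract_iff`, this is what makes the counit select a single term of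
the coproduct on either side. -/
theorem isResidue_toTwoGraph_iff (K : G.Subgraph) : K.toTwoGraph.IsResidue ↔ K = ⊥ := by
  constructor
  · refine fun h => le_bot_iff.mp fun x hx => ?_
    exact (K.ι_ne x hx ((toTwoGraph_ι_of_mem hx).symm.trans (h x))).elim
  · rintro rfl x
    exact if_neg not_mem_bot

theorem isResidue_contract_iff (K : G.Subgraph) : K.contract.IsResidue ↔ K = ⊤ := by
  constructor
  · refine fun h => top_le_iff.mp fun x hx => ?_
    by_contra hK
    exact hx (congrArg Subtype.val (h ⟨x, hK⟩))
  · rintro rfl x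
    exact Subtype.ext (not_not.mp x.2)

/-! ### Iterated subgraphs and contractions -/

/-- The part of `L` in `K`, as a subgraph of `K`. -/
def restrict (K L : G.Subgraph) : K.toTwoGraph.Subgraph where
  carrier := {h | h ∈ K.carrier ∧ h ∈ L.carrier}
  ι_mem h hh := by
    have : K.toTwoGraph.ι h = G.ι h := if_pos hh.1
    rw [this]
    exact ⟨K.ι_mem h hh.1, L.ι_mem h hh.2⟩
  ι_ne h hh := by
    have : K.toTwoGraph.ι h = G.ι h := if_pos hh.1
    rw [this]
    exact K.ι_ne h hh.1

/-- The image of `K` in the contraction `G / L`. -/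
def quot (L K : G.Subgraph) : L.contract.Subgraph where
  carrier := {h | h.1 ∈ K.carrier}
  ι_mem h hh := K.ι_mem h.1 hh
  ι_ne h hh h' := K.ι_ne h.1 hh (congrArg Subtype.val h')

theorem mem_of_mem_toTwoGraph (K : G.Subgraph) (L : K.toTwoGraph.Subgraph) {h : G.H}
    (hh : h ∈ L.carrier) : h ∈ K.carrier := by
  by_contra hK
  exact L.ι_ne h hh (if_neg hK)

/-- The subgraphs of `K` are the subgraphs of `G` contained in `K`. -/
def restrictEquiv (K : G.Subgraph) : {L : G.Subgraph // L ≤ K} ≃ K.toTwoGraph.Subgraph where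
  toFun L := K.restrict L.1
  invFun L := ⟨
    { carrier := L.carrier
      ι_mem := fun h hh => by
        have : K.toTwoGraph.ι h = G.ι h := if_pos (K.mem_of_mem_toTwoGraph L hh)
        rw [← this]
        exact L.ι_mem h hh
      ι_ne := fun h hh => K.ι_ne h (K.mem_of_mem_toTwoGraph L hh) },
    fun _ hh => K.mem_of_mem_toTwoGraph L hh⟩
  left_inv L := Subtype.ext <| Subgraph.ext <| Set.inter_eq_right.mpr L.2
  right_inv L := Subgraph.ext <| Set.inter_eq_right.mpr fun _ hh => K.mem_of_mem_toTwoGraph L hh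

/-- The subgraphs of `G / L` are the subgraphs of `G` containing `L`. -/
def quotEquiv (L : G.Subgraph) : {K : G.Subgraph // L ≤ K} ≃ L.contract.Subgraph where
  toFun K := L.quot K.1
  invFun M := ⟨
    -- This is the union of `L` with the edges of `M`: the condition is vacuous on `L`.
    { carrier := {h | ∀ hh : h ∉ L.carrier, (⟨h, hh⟩ : L.contract.H) ∈ M.carrier}
      ι_mem := fun h hh h' => M.ι_mem _ (hh fun hL => h' (L.ι_mem h hL))
      ι_ne := fun h hh => by
        by_cases hL : h ∈ L.carrier
        · exact L.ι_ne h hL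
        · exact fun h' => M.ι_ne _ (hh hL) (Subtype.ext h') },
    fun _ hL h' => (h' hL).elim⟩
  left_inv K := by
    refine Subtype.ext <| Subgraph.ext <| Set.ext fun h => ⟨fun hh => ?_, fun hh _ => hh⟩
    by_cases hL : h ∈ L.carrier
    exacts [K.2 hL, hh hL]
  right_inv M := Subgraph.ext <| Set.ext fun h => ⟨fun hh => hh h.2, fun hh _ => hh⟩

def isoRestrict {L K : G.Subgraph} (h : L ≤ K) : Iso (K.restrict L).toTwoGraph L.toTwoGraph where
  eV := Equiv.refl _
  eH := Equiv.refl _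
  eS := Equiv.refl _
  map_ν _ := rfl
  map_μ _ := rfl
  map_ι x := by
    by_cases hx : x ∈ L.carrier
    · exact (toTwoGraph_ι_of_mem hx).trans <| (toTwoGraph_ι_of_mem (h hx)).symm.trans
        (toTwoGraph_ι_of_mem (K := K.restrict L) ⟨h hx, hx⟩).symm
    · exact (toTwoGraph_ι_of_notMem hx).trans
        (toTwoGraph_ι_of_notMem (K := K.restrict L) fun h' => hx h'.2).symm
  map_σ₁ _ := rfl
  map_σ₂ s := by
    by_cases hx : G.μ s ∈ L.carrier
    · exact (toTwoGraph_σ₂_of_mem hx).trans <| (toTwoGraph_σ₂_of_mem (h hx)).symm.trans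
        (toTwoGraph_σ₂_of_mem (K := K.restrict L) ⟨h hx, hx⟩).symm
    · exact (toTwoGraph_σ₂_of_notMem hx).trans
        (toTwoGraph_σ₂_of_notMem (K := K.restrict L) fun h' => hx h'.2).symm

theorem mem_restrict {L K : G.Subgraph} (h : L ≤ K) (x : G.H) :
    x ∈ (K.restrict L).carrier ↔ x ∈ L.carrier :=
  ⟨fun hx => hx.2, fun hx => ⟨h hx, hx⟩⟩

/-- Both sides are `K / L`: one contracts `L` inside `K`, the other restricts `G / L` to the edges
of `K`. -/
def isoQuotToTwoGraph {L K : G.Subgraph} (h : L ≤ K) :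
    Iso (K.restrict L).contract (L.quot K).toTwoGraph where
  eV := Quot.congr (Equiv.refl _) fun a b => by
    constructor
    · rintro ⟨x, hx, rfl, rfl⟩
      refine ⟨x, hx.2, rfl, ?_⟩
      exact congrArg G.ν (if_pos hx.1).symm
    · rintro ⟨x, hx, rfl, rfl⟩
      refine ⟨x, ⟨h hx, hx⟩, rfl, ?_⟩
      exact congrArg G.ν (if_pos (h hx))
  eH := Equiv.subtypeEquivRight fun x => not_congr (mem_restrict h x)
  eS := Equiv.subtypeEquivRight fun s => not_congr (mem_restrict h (G.μ s))
  map_ν _ := rfl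
  map_μ _ := rfl
  map_ι x := by
    refine Subtype.ext ?_
    by_cases hx : x.1 ∈ K.carrier
    · exact (congrArg Subtype.val (toTwoGraph_ι_of_mem (K := L.quot K) (h := ⟨x.1, _⟩) hx)).trans
        (toTwoGraph_ι_of_mem hx).symm
    · exact (congrArg Subtype.val (toTwoGraph_ι_of_notMem (K := L.quot K) (h := ⟨x.1, _⟩) hx)).trans
        (toTwoGraph_ι_of_notMem hx).symm
  map_σ₁ s := by
    have := Face.map (G := K.toTwoGraph) (K := K.restrict L) (K' := L) (fun s => s)
      (fun _ => rfl) (fun s => (mem_restrict h (G.μ s)).symm)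
      (fun s hs => (toTwoGraph_σ₂_of_mem (K := K) (s := s) hs.1).symm)
      ((K.restrict L).face_faceEnd s.1 s.2)
    exact Subtype.ext (this.faceEnd_eq _)
  map_σ₂ s := by
    refine Subtype.ext ?_
    by_cases hx : G.μ s.1 ∈ K.carrier
    · exact (congrArg Subtype.val (toTwoGraph_σ₂_of_mem (K := L.quot K) (s := ⟨s.1, _⟩) hx)).trans
        (toTwoGraph_σ₂_of_mem hx).symm
    · exact (congrArg Subtype.val
        (toTwoGraph_σ₂_of_notMem (K := L.quot K) (s := ⟨s.1, _⟩) hx)).trans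
        (toTwoGraph_σ₂_of_notMem hx).symm

/-- A face of `L` is an initial segment of a chain of `K`. At its end `u`, the chain of `K` either
stops or crosses the edge of `K` at `u`, which lies outside `L`. -/
theorem Face.trans {L K : G.Subgraph} (hLK : L ≤ K) {s u : G.S} (h : L.Face s u) :
    (G.μ u ∉ K.carrier → K.Face s u) ∧
      (G.μ u ∈ K.carrier → ∀ t, K.Face (G.σ₂ u) t → K.Face s t) := by
  induction h with
  | last s _ => exact ⟨fun hu => Face.last s hu, fun hu t ht => Face.step hu ht⟩
  | step hs _ ih => exact ⟨fun hu => Face.step (hLK hs) (ih.1 hu),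
      fun hu t ht => Face.step (hLK hs) (ih.2 hu t ht)⟩

/-- Each `σ₁`-step in `G / L` is expanded into the external face of `L` that it abbreviates. -/
theorem Face.of_quot {L K : G.Subgraph} (hLK : L ≤ K) {s t : L.contract.S}
    (h : (L.quot K).Face s t) : K.Face s.1 t.1 := by
  induction h with
  | last s hs => exact ((L.face_faceEnd s.1 s.2).trans hLK).1 hs
  | step hs _ ih => exact ((L.face_faceEnd _ _).trans hLK).2 hs _ ih

/-- The components of `K / L` are the components of `K`. -/
def compQuotEquiv {L K : G.Subgraph} (hLK : L ≤ K) : (L.quot K).Comp ≃ K.Comp where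
  toFun := Quot.lift (Quot.lift K.comp fun _ _ ⟨h, hh, h1, h2⟩ => Quot.sound ⟨h, hLK hh, h1, h2⟩)
    (by
      rintro _ _ ⟨h, hh, rfl, rfl⟩
      exact Quot.sound ⟨h.1, hh, rfl, rfl⟩)
  invFun := Quot.lift (fun v => (L.quot K).comp (L.comp v)) <| by
    rintro _ _ ⟨h, hh, rfl, rfl⟩
    -- The ends of an edge of `L` are already the same vertex of `G / L`; any other edge of `K`
    -- survives as an edge of `K / L`.
    by_cases hL : h ∈ L.carrier
    · exact congrArg (L.quot K).comp (Quot.sound ⟨h, hL, rfl, rfl⟩)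
    · exact Quot.sound ⟨⟨h, hL⟩, hh, rfl, rfl⟩
  left_inv := by rintro ⟨⟨v⟩⟩; rfl
  right_inv := by rintro ⟨v⟩; rfl

def isoQuotContract {L K : G.Subgraph} (hLK : L ≤ K) : Iso (L.quot K).contract K.contract where
  eV := compQuotEquiv hLK
  eH :=
    { toFun := fun h => ⟨h.1.1, h.2⟩
      invFun := fun h => ⟨⟨h.1, fun hL => h.2 (hLK hL)⟩, h.2⟩
      left_inv := fun _ => rfl
      right_inv := fun _ => rfl }
  eS :=
    { toFun := fun s => ⟨s.1.1, s.2⟩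
      invFun := fun s => ⟨⟨s.1, fun hL => s.2 (hLK hL)⟩, s.2⟩
      left_inv := fun _ => rfl
      right_inv := fun _ => rfl }
  map_ν _ := rfl
  map_μ _ := rfl
  map_ι _ := rfl
  map_σ₁ s := Subtype.ext <| (((L.quot K).face_faceEnd s.1 s.2).of_quot hLK).faceEnd_eq _
  map_σ₂ _ := rfl

end Subgraph

theorem Iso.isResidue_iff {G G' : TwoGraph} (e : Iso G G') : G.IsResidue ↔ G'.IsResidue := by
  constructor
  · intro h x
    obtain ⟨x, rfl⟩ := e.eH.surjective x
    rw [e.map_ι, h x]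
  · intro h x
    exact e.eH.injective (by rw [← e.map_ι, h])

theorem isResidue_disjUnion_iff {G G' : TwoGraph} :
    (G.disjUnion G').IsResidue ↔ G.IsResidue ∧ G'.IsResidue :=
  ⟨fun h => ⟨fun x => Sum.inl_injective (h (Sum.inl x)),
    fun x => Sum.inr_injective (h (Sum.inr x))⟩, fun h => by
    rintro (x | x)
    exacts [congrArg Sum.inl (h.1 x), congrArg Sum.inr (h.2 x)]⟩

theorem IsResidue.subgraph_eq_bot {G : TwoGraph} (hG : G.IsResidue) (K : G.Subgraph) : K = ⊥ :=
  le_bot_iff.mp fun x hx => (K.ι_ne x hx (hG x)).elim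

end TwoGraph

end

/-! ### Sums over subgraphs and their multiplicativity -/

noncomputable section

namespace TwoGraph

open Subgraph

/-- Summation over chains `L ≤ K` of subgraphs, organized in two ways. -/
theorem sum_subgraph_toTwoGraph_eq_sum_subgraph_contract {M : Type*} [AddCommMonoid M]
    (G : TwoGraph) (f : ∀ K : G.Subgraph, K.toTwoGraph.Subgraph → M)
    (g : ∀ L : G.Subgraph, L.contract.Subgraph → M)
    (h : ∀ L K : G.Subgraph, L ≤ K → f K (K.restrict L) = g L (L.quot K)) :
    ∑ K, ∑ L, f K L = ∑ L, ∑ K, g L K := by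
  classical
  have h1 : ∀ K : G.Subgraph, ∑ L, f K L = ∑ L with L ≤ K, f K (K.restrict L) := fun K => by
    rw [← K.restrictEquiv.sum_comp]
    exact (Finset.sum_subtype (p := (· ≤ K)) _ (by simp) fun L => f K (K.restrict L)).symm
  have h2 : ∀ L : G.Subgraph, ∑ K, g L K = ∑ K with L ≤ K, g L (L.quot K) := fun L => by
    rw [← L.quotEquiv.sum_comp]
    exact (Finset.sum_subtype (p := (L ≤ ·)) _ (by simp) fun K => g L (L.quot K)).symm
  simp_rw [h1, h2]
  rw [Finset.sum_comm' (s' := fun L => {K | L ≤ K}) (t' := Finset.univ) (by simp)]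
  exact Finset.sum_congr rfl fun L _ => Finset.sum_congr rfl fun K hK =>
    h L K (Finset.mem_filter.mp hK).2

/-- The sum over all subgraphs of a product of functions of the subgraph and the contraction. -/
def convolve {A : Type*} [CommSemiring A] (f g : TwoGraph → A) (G : TwoGraph) : A :=
  ∑ K : G.Subgraph, f K.toTwoGraph * g K.contract

section convolve

variable {A : Type*} [CommSemiring A] {f g : TwoGraph → A}

theorem convolve_congr (hf : ∀ G G', Iso G G' → f G = f G') (hg : ∀ G G', Iso G G' → g G = g G')
    (G G' : TwoGraph) (e : Iso G G') : convolve f g G = convolve f g G' :=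
  Fintype.sum_equiv (mapEquiv e) _ _ fun K => by
    rw [hf _ _ (isoToTwoGraph e K (K.map e) (K.mem_map e)),
      hg _ _ (isoContract e K (K.map e) (K.mem_map e))]
    rfl

theorem convolve_of_isResidue (hf : ∀ G G', Iso G G' → f G = f G')
    (hg : ∀ G G', Iso G G' → g G = g G') {G : TwoGraph} (hG : G.IsResidue) :
    convolve f g G = f G * g G := by
  have h := hf _ _ (isoTop G)
  -- In a residue the full subgraph is also the empty one, so `isoTop` serves for `⊥`.
  rw [hG.subgraph_eq_bot ⊤] at h
  rw [convolve, Fintype.sum_eq_single ⊥ fun K hK => absurd (hG.subgraph_eq_bot K) hK, h,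
    ← hg _ _ (isoBot G)]

/-- Kept apart from the multiplicativity of `f` and `g`, because the proof that `convInv` is
multiplicative needs this expansion while multiplicativity is known only on smaller graphs. -/
theorem convolve_disjUnion_eq_sum (hf : ∀ G G', Iso G G' → f G = f G')
    (hg : ∀ G G', Iso G G' → g G = g G') (G G' : TwoGraph) :
    convolve f g (G.disjUnion G') = ∑ p : G.Subgraph × G'.Subgraph,
      f (p.1.toTwoGraph.disjUnion p.2.toTwoGraph) * g (p.1.contract.disjUnion p.2.contract) :=
  (Fintype.sum_equiv (sumEquiv G G') _ _ fun p => by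
    rw [← hf _ _ (isoSumToTwoGraph p.1 p.2), hg _ _ (isoSumContract p.1 p.2)]
    rfl).symm

theorem convolve_mul_convolve (G G' : TwoGraph) :
    convolve f g G * convolve f g G' = ∑ p : G.Subgraph × G'.Subgraph,
      (f p.1.toTwoGraph * f p.2.toTwoGraph) * (g p.1.contract * g p.2.contract) := by
  rw [convolve, convolve, Fintype.sum_mul_sum, Fintype.sum_prod_type]
  simp_rw [mul_mul_mul_comm]

theorem convolve_disjUnion (hf : ∀ G G', Iso G G' → f G = f G')
    (hg : ∀ G G', Iso G G' → g G = g G')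
    (hf' : ∀ G G', f (G.disjUnion G') = f G * f G')
    (hg' : ∀ G G', g (G.disjUnion G') = g G * g G') (G G' : TwoGraph) :
    convolve f g (G.disjUnion G') = convolve f g G * convolve f g G' := by
  rw [convolve_disjUnion_eq_sum hf hg, convolve_mul_convolve]
  simp_rw [hf', hg']

end convolve

theorem isResidue_empty : empty.IsResidue := fun h => h.elim

end TwoGraph

/-! ### Isomorphism invariants and graphs as algebra elements -/

namespace UTwoGraph

theorem mk_eq {G G' : TwoGraph} (e : G.Iso G') : mk G = mk G' := Quotient.sound ⟨e⟩

theorem mk_disjUnion (G G' : TwoGraph) : mk (G.disjUnion G') = mk G * mk G' := rfl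

theorem mk_empty : mk TwoGraph.empty = 1 := rfl

theorem exists_mk_eq (Γ : UTwoGraph) : ∃ G, mk G = Γ := Quotient.exists_rep Γ

theorem mk_mem_residues {G : TwoGraph} : mk G ∈ residues ↔ G.IsResidue := by
  constructor
  · rintro ⟨G', hG', h⟩
    obtain ⟨e⟩ := Quotient.exact h
    exact e.isResidue_iff.mp hG'
  · exact fun h => ⟨G, h, rfl⟩

/-- A multiplicative isomorphism invariant of 2-graphs, as a homomorphism of monoids. -/
def lift {A : Type*} [CommMonoid A] (f : TwoGraph → A) (hf : ∀ G G', TwoGraph.Iso G G' → f G = f G')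
    (h1 : f TwoGraph.empty = 1) (hmul : ∀ G G', f (G.disjUnion G') = f G * f G') :
    UTwoGraph →* A where
  toFun := Quotient.lift f fun _ _ ⟨e⟩ => hf _ _ e
  map_one' := h1
  map_mul' := by
    rintro ⟨G⟩ ⟨G'⟩
    exact hmul G G'

end UTwoGraph

namespace TwoGraph

theorem gen_eq (G G' : TwoGraph) (e : Iso G G') : G.gen = G'.gen :=
  congrArg UTwoGraph.gen (UTwoGraph.mk_eq e)

theorem gen_disjUnion (G G' : TwoGraph) : (G.disjUnion G').gen = G.gen * G'.gen := by
  rw [gen, UTwoGraph.mk_disjUnion, UTwoGraph.gen, map_mul, map_mul]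
  rfl

theorem gen_empty : empty.gen = 1 := by
  rw [gen, UTwoGraph.mk_empty, UTwoGraph.gen, map_one, map_one]

theorem IsResidue.isUnit_gen {G : TwoGraph} (hG : G.IsResidue) : IsUnit G.gen :=
  IsLocalization.map_units AugTwoGraphAlgebra
    (⟨_, Submonoid.mem_map_of_mem _ (UTwoGraph.mk_mem_residues.mpr hG)⟩ :
      UTwoGraph.residues.map (MonoidAlgebra.of ℚ UTwoGraph))

end TwoGraph

/-! ### Homomorphisms out of the localized algebra; coproduct and counit -/

namespace AugTwoGraphAlgebra

section lift

variable {A : Type*} [CommRing A] [Algebra ℚ A]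

/-- The algebra homomorphism with given values on 2-graphs, units on residues. -/
def lift (f : TwoGraph → A) (hf : ∀ G G', TwoGraph.Iso G G' → f G = f G')
    (h1 : f TwoGraph.empty = 1) (hmul : ∀ G G', f (G.disjUnion G') = f G * f G')
    (hu : ∀ G : TwoGraph, G.IsResidue → IsUnit (f G)) : AugTwoGraphAlgebra →ₐ[ℚ] A :=
  IsLocalization.liftAlgHom (M := UTwoGraph.residues.map (MonoidAlgebra.of ℚ UTwoGraph))
    (f := MonoidAlgebra.lift ℚ A UTwoGraph (UTwoGraph.lift f hf h1 hmul)) <| by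
    rintro ⟨_, _, ⟨G, hG, rfl⟩, rfl⟩
    rw [MonoidAlgebra.lift_of]
    exact hu G hG

theorem lift_gen (f : TwoGraph → A) (hf : ∀ G G', TwoGraph.Iso G G' → f G = f G')
    (h1 : f TwoGraph.empty = 1) (hmul : ∀ G G', f (G.disjUnion G') = f G * f G')
    (hu : ∀ G : TwoGraph, G.IsResidue → IsUnit (f G)) (G : TwoGraph) :
    lift f hf h1 hmul hu G.gen = f G := by
  rw [lift, IsLocalization.liftAlgHom_apply, TwoGraph.gen, UTwoGraph.gen]
  exact (IsLocalization.lift_eq _ _).trans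
    (MonoidAlgebra.lift_of (UTwoGraph.lift f hf h1 hmul) (UTwoGraph.mk G))

/-- Graphs span the unlocalized algebra, and a homomorphism on a localization is determined by its
restriction; the formal inverses need no check. -/
theorem algHom_ext {B : Type*} [Semiring B] [Algebra ℚ B] {φ ψ : AugTwoGraphAlgebra →ₐ[ℚ] B}
    (h : ∀ G : TwoGraph, φ G.gen = ψ G.gen) : φ = ψ := by
  refine AlgHom.coe_ringHom_injective <| IsLocalization.ringHom_ext
    (UTwoGraph.residues.map (MonoidAlgebra.of ℚ UTwoGraph)) ?_
  have : φ.comp (IsScalarTower.toAlgHom ℚ TwoGraphAlgebra AugTwoGraphAlgebra) =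
      ψ.comp (IsScalarTower.toAlgHom ℚ TwoGraphAlgebra AugTwoGraphAlgebra) := by
    apply MonoidAlgebra.algHom_ext
    · intro Γ
      obtain ⟨G, rfl⟩ := Γ.exists_mk_eq
      exact h G
    · exact Subsingleton.elim _ _
  exact congrArg AlgHom.toRingHom this

end lift

open TwoGraph Subgraph

/-- The coproduct of a 2-graph. -/
theorem sum_tmul_eq_convolve (G : TwoGraph) :
    ∑ K : G.Subgraph, K.toTwoGraph.gen ⊗ₜ[ℚ] K.contract.gen =
      convolve (fun G => G.gen ⊗ₜ[ℚ] (1 : AugTwoGraphAlgebra))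
        (fun G => (1 : AugTwoGraphAlgebra) ⊗ₜ[ℚ] G.gen) G := by
  simp [convolve]

/-- The coproduct on the algebra of 2-graphs. -/
def comul : AugTwoGraphAlgebra →ₐ[ℚ] AugTwoGraphAlgebra ⊗[ℚ] AugTwoGraphAlgebra :=
  have hl : ∀ G G', TwoGraph.Iso G G' → G.gen ⊗ₜ[ℚ] (1 : AugTwoGraphAlgebra) = G'.gen ⊗ₜ 1 :=
    fun G G' e => by rw [gen_eq G G' e]
  have hr : ∀ G G', TwoGraph.Iso G G' → (1 : AugTwoGraphAlgebra) ⊗ₜ[ℚ] G.gen = 1 ⊗ₜ G'.gen :=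
    fun G G' e => by rw [gen_eq G G' e]
  lift (convolve (fun G => G.gen ⊗ₜ[ℚ] (1 : AugTwoGraphAlgebra))
      (fun G => (1 : AugTwoGraphAlgebra) ⊗ₜ[ℚ] G.gen))
    (convolve_congr hl hr)
    (by
      rw [convolve_of_isResidue hl hr isResidue_empty, gen_empty, ← Algebra.TensorProduct.one_def,
        one_mul])
    (convolve_disjUnion hl hr (by simp [gen_disjUnion]) (by simp [gen_disjUnion]))
    -- A residue is sent to `G ⊗ G`, a product of two units.
    (fun G hG => by
      rw [convolve_of_isResidue hl hr hG]
      exact (hG.isUnit_gen.map (Algebra.TensorProduct.includeLeft (R := ℚ) (S := ℚ))).mul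
        (hG.isUnit_gen.map (Algebra.TensorProduct.includeRight (R := ℚ))))

theorem comul_gen (G : TwoGraph) :
    comul G.gen = ∑ K : G.Subgraph, K.toTwoGraph.gen ⊗ₜ[ℚ] K.contract.gen := by
  rw [sum_tmul_eq_convolve, comul, lift_gen]

open Classical in
/-- The counit on the algebra of 2-graphs. -/
def counit : AugTwoGraphAlgebra →ₐ[ℚ] ℚ :=
  lift (fun G => if G.IsResidue then 1 else 0)
    (fun _ _ e => by simp only [e.isResidue_iff])
    (if_pos isResidue_empty)
    (fun G G' => by
      by_cases h : G.IsResidue <;> simp [isResidue_disjUnion_iff, h])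
    (fun G hG => by simp [hG])

theorem counit_gen_of_isResidue {G : TwoGraph} (hG : G.IsResidue) : counit G.gen = 1 := by
  rw [counit, lift_gen, if_pos hG]

theorem counit_gen_of_not_isResidue {G : TwoGraph} (hG : ¬ G.IsResidue) : counit G.gen = 0 := by
  rw [counit, lift_gen, if_neg hG]

/-- On `G`, both sides are the sum over `L ≤ K` of `L ⊗ K / L ⊗ G / K`. -/
theorem coassoc :
    (Algebra.TensorProduct.assoc ℚ ℚ ℚ AugTwoGraphAlgebra AugTwoGraphAlgebra
          AugTwoGraphAlgebra).toAlgHom.comp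
          ((Algebra.TensorProduct.map comul (AlgHom.id ℚ AugTwoGraphAlgebra)).comp comul) =
        (Algebra.TensorProduct.map (AlgHom.id ℚ AugTwoGraphAlgebra) comul).comp comul := by
  apply algHom_ext
  intro G
  have h := sum_subgraph_toTwoGraph_eq_sum_subgraph_contract G
    (fun K L => L.toTwoGraph.gen ⊗ₜ[ℚ] (L.contract.gen ⊗ₜ[ℚ] K.contract.gen))
    (fun L K => L.toTwoGraph.gen ⊗ₜ[ℚ] (K.toTwoGraph.gen ⊗ₜ[ℚ] K.contract.gen))
    (fun L K h => by
      rw [gen_eq _ _ (isoRestrict h), gen_eq _ _ (isoQuotToTwoGraph h),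
        gen_eq _ _ (isoQuotContract h)])
  simpa [comul_gen, TensorProduct.sum_tmul, TensorProduct.tmul_sum] using h

theorem counit_comul :
    (Algebra.TensorProduct.map counit (AlgHom.id ℚ AugTwoGraphAlgebra)).comp comul =
        (Algebra.TensorProduct.lid ℚ AugTwoGraphAlgebra).symm.toAlgHom := by
  refine algHom_ext fun G => ?_
  have : ∑ K : G.Subgraph, counit K.toTwoGraph.gen ⊗ₜ[ℚ] K.contract.gen = 1 ⊗ₜ[ℚ] G.gen := by
    rw [Fintype.sum_eq_single ⊥ fun K hK => by
        rw [counit_gen_of_not_isResidue (mt (isResidue_toTwoGraph_iff K).mp hK),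
          TensorProduct.zero_tmul],
      counit_gen_of_isResidue ((isResidue_toTwoGraph_iff _).mpr rfl), ← gen_eq _ _ (isoBot G)]
  simpa [comul_gen] using this

theorem comul_counit :
    (Algebra.TensorProduct.map (AlgHom.id ℚ AugTwoGraphAlgebra) counit).comp comul =
        (Algebra.TensorProduct.rid ℚ ℚ AugTwoGraphAlgebra).symm.toAlgHom := by
  refine algHom_ext fun G => ?_
  have : ∑ K : G.Subgraph, K.toTwoGraph.gen ⊗ₜ[ℚ] counit K.contract.gen = G.gen ⊗ₜ[ℚ] 1 := by
    rw [Fintype.sum_eq_single ⊤ fun K hK => by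
        rw [counit_gen_of_not_isResidue (mt (isResidue_contract_iff K).mp hK),
          TensorProduct.tmul_zero],
      counit_gen_of_isResidue ((isResidue_contract_iff _).mpr rfl), gen_eq _ _ (isoTop G)]
  simpa [comul_gen] using this

end AugTwoGraphAlgebra

end

/-! ### Convolution inverses by recursion on edges, and the antipode -/

noncomputable section

namespace TwoGraph

open Subgraph

/-- The number of half-edges of a 2-graph that belong to edges. -/
def edgeSize (G : TwoGraph) : ℕ := (⊤ : G.Subgraph).carrier.ncard

theorem edgeSize_toTwoGraph {G : TwoGraph} (K : G.Subgraph) :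
    K.toTwoGraph.edgeSize = K.carrier.ncard := by
  refine congrArg Set.ncard (Set.ext fun h => ⟨fun hh => ?_, fun hh => ?_⟩)
  · by_contra hK
    exact hh (toTwoGraph_ι_of_notMem hK)
  · exact fun h' => K.ι_ne h hh ((toTwoGraph_ι_of_mem hh).symm.trans h')

theorem edgeSize_toTwoGraph_le {G : TwoGraph} (K : G.Subgraph) :
    K.toTwoGraph.edgeSize ≤ G.edgeSize := by
  rw [edgeSize_toTwoGraph]
  exact Set.ncard_le_ncard (le_top : K ≤ ⊤)

theorem edgeSize_toTwoGraph_lt {G : TwoGraph} {K : G.Subgraph} (hK : K ≠ ⊤) :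
    K.toTwoGraph.edgeSize < G.edgeSize := by
  rw [edgeSize_toTwoGraph]
  exact Set.ncard_lt_ncard (lt_top_iff_ne_top.mpr hK : K < ⊤)

end TwoGraph

namespace AugTwoGraphAlgebra

open TwoGraph Subgraph

variable {A : Type*} [CommRing A] [Algebra ℚ A] (φ : AugTwoGraphAlgebra →ₐ[ℚ] A)

open Classical in
/-- The left convolution inverse of an algebra homomorphism, on 2-graphs. -/
def convInv (G : TwoGraph) : A :=
  -- This solves `∑ K, convInv K * φ (G / K) = ε G` for the term `K = ⊤`. Since `G / ⊤` is a
  -- residue, `Ring.inverse` is applied to a unit and its default value `0` plays no role.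
  (algebraMap ℚ A (counit G.gen) -
    ∑ K : {K : G.Subgraph // K ≠ ⊤}, convInv K.1.toTwoGraph * φ K.1.contract.gen) *
      Ring.inverse (φ (⊤ : G.Subgraph).contract.gen)
termination_by G.edgeSize
decreasing_by exact edgeSize_toTwoGraph_lt K.2

theorem isUnit_apply_gen {G : TwoGraph} (hG : G.IsResidue) : IsUnit (φ G.gen) :=
  hG.isUnit_gen.map φ

theorem isResidue_contract_top (G : TwoGraph) : (⊤ : G.Subgraph).contract.IsResidue :=
  (isResidue_contract_iff _).mpr rfl

open Classical in
theorem convInv_mul (G : TwoGraph) :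
    convInv φ G * φ (⊤ : G.Subgraph).contract.gen = algebraMap ℚ A (counit G.gen) -
      ∑ K : {K : G.Subgraph // K ≠ ⊤}, convInv φ K.1.toTwoGraph * φ K.1.contract.gen := by
  rw [convInv, mul_assoc, Ring.inverse_mul_cancel _ (isUnit_apply_gen φ (isResidue_contract_top G)),
    mul_one]

theorem convInv_congr (G G' : TwoGraph) (e : TwoGraph.Iso G G') : convInv φ G = convInv φ G' := by
  induction hn : G.edgeSize using Nat.strong_induction_on generalizing G G' with
  | _ n ih =>
  classical
  subst hn
  -- Fullness of a subgraph is detected by its contraction being a residue, which is isomorphism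
  -- invariant.
  have htop : ∀ K : G.Subgraph, K = ⊤ ↔ K.map e = ⊤ := fun K => by
    rw [← isResidue_contract_iff, ← isResidue_contract_iff]
    exact (isoContract e K _ (K.mem_map e)).isResidue_iff
  rw [convInv, convInv, gen_eq _ _ e,
    gen_eq _ _ (isoContract e ⊤ _ (mem_map e ⊤)), (htop ⊤).mp rfl]
  congr 2
  refine Fintype.sum_equiv ((mapEquiv e).subtypeEquiv fun K => not_congr (htop K)) _ _ fun K => ?_
  rw [ih _ (edgeSize_toTwoGraph_lt K.2) _ _ (isoToTwoGraph e K.1 _ (K.1.mem_map e)) rfl,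
    gen_eq _ _ (isoContract e K.1 _ (K.1.mem_map e))]
  rfl

theorem convolve_convInv (G : TwoGraph) :
    convolve (convInv φ) (fun G => φ G.gen) G = algebraMap ℚ A (counit G.gen) := by
  classical
  rw [convolve, Fintype.sum_eq_add_sum_subtype_ne _ (⊤ : G.Subgraph),
    convInv_congr φ _ _ (isoTop G), convInv_mul, sub_add_cancel]

theorem convInv_mul_of_isResidue {G : TwoGraph} (hG : G.IsResidue) :
    convInv φ G * φ G.gen = 1 := by
  rw [← convolve_of_isResidue (convInv_congr φ) (fun G G' e => congrArg φ (gen_eq G G' e)) hG,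
    convolve_convInv, counit_gen_of_isResidue hG, map_one]

/-- The counit is multiplicative, so the defining equation for the union is the product of the two
defining equations. Expanded over pairs of subgraphs, all terms except `(⊤, ⊤)` agree by induction
on the number of edges; what remains differs by a common unit factor. -/
theorem convInv_disjUnion (G G' : TwoGraph) :
    convInv φ (G.disjUnion G') = convInv φ G * convInv φ G' := by
  induction hn : G.edgeSize + G'.edgeSize using Nat.strong_induction_on generalizing G G' with
  | _ n ih =>
  classical
  subst hn
  have hφ : ∀ G G' : TwoGraph, φ (G.disjUnion G').gen = φ G.gen * φ G'.gen := fun G G' => by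
    rw [gen_disjUnion, map_mul]
  have h : convolve (convInv φ) (fun G => φ G.gen) (G.disjUnion G') =
      convolve (convInv φ) (fun G => φ G.gen) G * convolve (convInv φ) (fun G => φ G.gen) G' := by
    simp only [convolve_convInv, gen_disjUnion, map_mul]
  rw [convolve_disjUnion_eq_sum (convInv_congr φ) (fun G G' e => congrArg φ (gen_eq G G' e)),
    convolve_mul_convolve, Fintype.sum_eq_add_sum_subtype_ne _ (⊤, ⊤),
    Fintype.sum_eq_add_sum_subtype_ne _ (⊤, ⊤)] at h
  simp only [hφ] at h
  have h' : ∀ p : {p : G.Subgraph × G'.Subgraph // p ≠ (⊤, ⊤)},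
      convInv φ (p.1.1.toTwoGraph.disjUnion p.1.2.toTwoGraph) =
        convInv φ p.1.1.toTwoGraph * convInv φ p.1.2.toTwoGraph := by
    rintro ⟨⟨K, K'⟩, hK⟩
    refine ih _ ?_ _ _ rfl
    -- A pair other than `(⊤, ⊤)` loses an edge in at least one component, so the total size drops.
    by_cases hK1 : K = ⊤
    · have hK2 : K' ≠ ⊤ := fun hK2 => hK (by rw [hK1, hK2])
      exact add_lt_add_of_le_of_lt (edgeSize_toTwoGraph_le K) (edgeSize_toTwoGraph_lt hK2)
    · exact add_lt_add_of_lt_of_le (edgeSize_toTwoGraph_lt hK1) (edgeSize_toTwoGraph_le K')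
  simp only [h', add_left_inj] at h
  rw [((isUnit_apply_gen φ (isResidue_contract_top G)).mul
    (isUnit_apply_gen φ (isResidue_contract_top G'))).mul_left_inj] at h
  rwa [convInv_congr φ _ _ ((isoTop G).disjUnion (isoTop G')), convInv_congr φ _ _ (isoTop G),
    convInv_congr φ _ _ (isoTop G')] at h

/-- The left convolution inverse of an algebra homomorphism. -/
def convInvAlgHom : AugTwoGraphAlgebra →ₐ[ℚ] A :=
  lift (convInv φ) (convInv_congr φ)
    (by simpa [gen_empty] using convInv_mul_of_isResidue φ isResidue_empty)
    (convInv_disjUnion φ)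
    fun _ hG => .of_mul_eq_one _ (convInv_mul_of_isResidue φ hG)

theorem convInvAlgHom_gen (G : TwoGraph) : convInvAlgHom φ G.gen = convInv φ G :=
  lift_gen _ _ _ _ _ G

instance : Bialgebra ℚ AugTwoGraphAlgebra :=
  Bialgebra.ofAlgHom comul counit coassoc counit_comul comul_counit

open WithConv

theorem convInvAlgHom_mul : toConv (convInvAlgHom φ) * toConv φ = 1 := by
  refine WithConv.ofConv_injective (algHom_ext fun G => ?_)
  have h : (Algebra.TensorProduct.lmul' ℚ (S := A)) (Algebra.TensorProduct.map (convInvAlgHom φ) φ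
      (comul G.gen)) = algebraMap ℚ A (counit G.gen) := by
    rw [← convolve_convInv φ G, comul_gen, convolve]
    simp [convInvAlgHom_gen]
  exact h

/-- The left inverse of `φ` has a left inverse of its own, and in a monoid this must be `φ`; so the
inverse is two-sided. -/
theorem mul_convInvAlgHom : toConv φ * toConv (convInvAlgHom φ) = 1 := by
  have h := convInvAlgHom_mul (convInvAlgHom φ)
  rwa [left_inv_eq_right_inv h (convInvAlgHom_mul φ)] at h

/-- The antipode on the algebra of 2-graphs. -/
def antipode : AugTwoGraphAlgebra →ₐ[ℚ] AugTwoGraphAlgebra := convInvAlgHom (AlgHom.id ℚ _)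

instance : HopfAlgebra ℚ AugTwoGraphAlgebra where
  antipode := antipode.toLinearMap
  mul_antipode_rTensor_comul :=
    congrArg (fun f => f.ofConv.toLinearMap) (convInvAlgHom_mul (AlgHom.id ℚ AugTwoGraphAlgebra))
  mul_antipode_lTensor_comul :=
    congrArg (fun f => f.ofConv.toLinearMap) (mul_convInvAlgHom (AlgHom.id ℚ AugTwoGraphAlgebra))

end AugTwoGraphAlgebra

/-! ### Uniqueness of the antipode and the convolution group -/

section Hopf

open WithConv

variable {C : Type*} [CommRing C] [HopfAlgebra ℚ C]

/-- The antipode is the convolution inverse of the identity. -/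
theorem convolution_id_eq_iff (T : C →ₗ[ℚ] C) :
    (convolution Coalgebra.comul T LinearMap.id =
        Algebra.linearMap ℚ C ∘ₗ Coalgebra.counit ∧
      convolution Coalgebra.comul LinearMap.id T =
        Algebra.linearMap ℚ C ∘ₗ Coalgebra.counit) ↔ T = HopfAlgebra.antipode ℚ := by
  constructor
  -- A left inverse of the identity already equals the antipode, which is a right inverse.
  · rintro ⟨h, -⟩
    have h1 : toConv T * toConv LinearMap.id = 1 := WithConv.ofConv_injective h
    exact WithConv.toConv_injective (left_inv_eq_right_inv h1 LinearMap.id_mul_antipode)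
  · rintro rfl
    exact ⟨congrArg ofConv LinearMap.antipode_mul_id, congrArg ofConv LinearMap.id_mul_antipode⟩

/-- Apply `φ` to `S * id = 1`: composition with an algebra homomorphism distributes over
convolution. -/
theorem comp_antipode_mul {A : Type*} [CommRing A] [Algebra ℚ A] (φ : C →ₐ[ℚ] A) :
    toConv (φ.comp (HopfAlgebra.antipodeAlgHom ℚ C)) * toConv φ = 1 := by
  have h := AlgHom.comp_convMul_distrib φ (toConv (HopfAlgebra.antipodeAlgHom ℚ C))
    (toConv (AlgHom.id ℚ C))
  rw [AlgHom.antipode_id_cancel] at h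
  refine (WithConv.ofConv_injective h).symm.trans (WithConv.ofConv_injective ?_)
  ext c
  simp

/-- The algebra homomorphisms from a Hopf algebra to a commutative algebra form a group. -/
abbrev convGroupAlgHom (A : Type*) [CommRing A] [Algebra ℚ A] : Group (WithConv (C →ₐ[ℚ] A)) where
  inv φ := toConv (φ.ofConv.comp (HopfAlgebra.antipodeAlgHom ℚ C))
  inv_mul_cancel φ := comp_antipode_mul φ.ofConv

theorem exists_group_algHom (A : Type*) [CommRing A] [Algebra ℚ A] :
    ∃ _ : Group (C →ₐ[ℚ] A),
      (∀ φ ψ : C →ₐ[ℚ] A, (φ * ψ).toLinearMap =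
        convolution Coalgebra.comul φ.toLinearMap ψ.toLinearMap) ∧
      (1 : C →ₐ[ℚ] A) = (Algebra.ofId ℚ A).comp (Bialgebra.counitAlgHom ℚ C) ∧
      ∀ φ : C →ₐ[ℚ] A, (φ⁻¹).toLinearMap = φ.toLinearMap ∘ₗ HopfAlgebra.antipode ℚ :=
  let _ := convGroupAlgHom (C := C) A
  -- The convolution structure lives on the type synonym `WithConv`; transporting it back makes all
  -- the formulas hold by definition.
  ⟨(WithConv.equiv (C →ₐ[ℚ] A)).symm.group, fun _ _ => rfl, rfl, fun _ => rfl⟩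

end Hopf

end

/-! ### Contraction closures and Hopf subalgebras -/

noncomputable section

namespace UTwoGraph

open TwoGraph Subgraph

theorem toTwoGraph_mem_ofVertexTypes {𝒱 : Set UOneGraph} {G : TwoGraph}
    (hG : mk G ∈ ofVertexTypes 𝒱) (K : G.Subgraph) : mk K.toTwoGraph ∈ ofVertexTypes 𝒱 := by
  obtain ⟨G', hG', h⟩ := hG
  obtain ⟨e⟩ := Quotient.exact h.symm
  -- Dropping edges changes only `ι` and `σ₂`, which vertex graphs do not see, so `hG'` applies
  -- unchanged.
  exact ⟨(K.map e).toTwoGraph, hG', (mk_eq (isoToTwoGraph e K _ (K.mem_map e))).symm⟩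

/-- Subgraphs and contractions of a contraction `G / L` come from subgraphs `K ≥ L` of `G`. -/
theorem exists_quot_of_mem_contractionClosure {𝒦 : Set UTwoGraph} {G : TwoGraph}
    (hG : mk G ∈ contractionClosure 𝒦) (K : G.Subgraph) :
    ∃ (G' : TwoGraph) (L M : G'.Subgraph), mk G' ∈ 𝒦 ∧
      mk K.toTwoGraph = mk (M.restrict L).contract ∧ mk K.contract = mk M.contract := by
  obtain ⟨G', L, hG', h⟩ := hG
  obtain ⟨e⟩ := Quotient.exact h.symm
  obtain ⟨⟨M, hM⟩, h⟩ := L.quotEquiv.surjective (K.map e)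
  have hK : ∀ x, e.eH x ∈ (L.quot M).carrier ↔ x ∈ K.carrier := fun x => by
    rw [← K.mem_map e, ← h]
    rfl
  exact ⟨G', L, M, hG',
    (mk_eq (isoToTwoGraph e K _ hK)).trans (mk_eq (isoQuotToTwoGraph hM)).symm,
    (mk_eq (isoContract e K _ hK)).trans (mk_eq (isoQuotContract hM))⟩

/-- A set of 2-graphs that is closed under subgraphs and contractions. -/
structure IsClosed (𝒦 : Set UTwoGraph) : Prop where
  toTwoGraph_mem : ∀ G : TwoGraph, mk G ∈ 𝒦 → ∀ K : G.Subgraph, mk K.toTwoGraph ∈ 𝒦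
  contract_mem : ∀ G : TwoGraph, mk G ∈ 𝒦 → ∀ K : G.Subgraph, mk K.contract ∈ 𝒦

/-- A subgraph of `G' / L` is `M / L` for some `M ≥ L`. It is a contraction of `M`, which has the
same vertex graphs as `G'`, and contracting it in `G' / L` gives `G' / M`. -/
theorem isClosed_contractionClosure (𝒱 : Set UOneGraph) :
    IsClosed (contractionClosure (ofVertexTypes 𝒱)) where
  toTwoGraph_mem G hG K := by
    obtain ⟨G', L, M, hG', h, -⟩ := exists_quot_of_mem_contractionClosure hG K
    exact ⟨M.toTwoGraph, M.restrict L, toTwoGraph_mem_ofVertexTypes hG' M, h.symm⟩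
  contract_mem G hG K := by
    obtain ⟨G', L, M, hG', -, h⟩ := exists_quot_of_mem_contractionClosure hG K
    exact ⟨G', M, hG', h.symm⟩

end UTwoGraph

namespace AugTwoGraphAlgebra

open TwoGraph Subgraph

theorem comul_gen_of_isResidue {G : TwoGraph} (hG : G.IsResidue) :
    comul G.gen = G.gen ⊗ₜ G.gen := by
  have h := gen_eq _ _ (isoTop G)
  rw [hG.subgraph_eq_bot ⊤] at h
  rw [comul_gen, Fintype.sum_eq_single ⊥ fun K hK => absurd (hG.subgraph_eq_bot K) hK, h,
    ← gen_eq _ _ (isoBot G)]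

/-- The inverse of a group-like element is group-like, by uniqueness of inverses in the tensor
square. -/
theorem comul_of_mul_gen_eq_one {G : TwoGraph} (hG : G.IsResidue) {x : AugTwoGraphAlgebra}
    (hx : x * G.gen = 1) : comul x = x ⊗ₜ x := by
  have h : comul x * comul G.gen = 1 := by rw [← map_mul, hx, map_one]
  refine left_inv_eq_right_inv h ?_
  rw [comul_gen_of_isResidue hG, Algebra.TensorProduct.tmul_mul_tmul, mul_comm, hx,
    Algebra.TensorProduct.one_def]

theorem tmul_mem_range {C : Type*} [CommRing C] [Algebra ℚ C] {B : Subalgebra ℚ C} {x y : C}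
    (hx : x ∈ B) (hy : y ∈ B) : x ⊗ₜ[ℚ] y ∈ (Algebra.TensorProduct.map B.val B.val).range :=
  ⟨(⟨x, hx⟩ : B) ⊗ₜ[ℚ] (⟨y, hy⟩ : B), rfl⟩

variable {𝒦 : Set UTwoGraph}

theorem comul_gen_mem_range (h𝒦 : UTwoGraph.IsClosed 𝒦) {B : Subalgebra ℚ AugTwoGraphAlgebra}
    (hB : UTwoGraph.gen '' 𝒦 ⊆ B) {G : TwoGraph} (hG : UTwoGraph.mk G ∈ 𝒦) :
    comul G.gen ∈ (Algebra.TensorProduct.map B.val B.val).range := by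
  rw [comul_gen]
  exact sum_mem fun K _ => tmul_mem_range (hB ⟨_, h𝒦.toTwoGraph_mem G hG K, rfl⟩)
    (hB ⟨_, h𝒦.contract_mem G hG K, rfl⟩)

theorem isSubbialgebra_graphSubalgebra (h𝒦 : UTwoGraph.IsClosed 𝒦) :
    IsSubbialgebra comul.toLinearMap (graphSubalgebra 𝒦) := by
  -- The coproduct is an algebra homomorphism, so it suffices to check generators.
  suffices h : graphSubalgebra 𝒦 ≤ Subalgebra.comap comul (Algebra.TensorProduct.map
      (graphSubalgebra 𝒦).val (graphSubalgebra 𝒦).val).range from fun x hx => h hx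
  refine Algebra.adjoin_le ?_
  rintro _ ⟨Γ, hΓ, rfl⟩
  obtain ⟨G, rfl⟩ := Γ.exists_mk_eq
  exact comul_gen_mem_range h𝒦 Algebra.subset_adjoin hΓ

theorem isSubbialgebra_augGraphSubalgebra (h𝒦 : UTwoGraph.IsClosed 𝒦) :
    IsSubbialgebra comul.toLinearMap (augGraphSubalgebra 𝒦) := by
  suffices h : augGraphSubalgebra 𝒦 ≤ Subalgebra.comap comul (Algebra.TensorProduct.map
      (augGraphSubalgebra 𝒦).val (augGraphSubalgebra 𝒦).val).range from fun x hx => h hx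
  refine Algebra.adjoin_le ?_
  rintro x (⟨Γ, hΓ, rfl⟩ | hx)
  · obtain ⟨G, rfl⟩ := Γ.exists_mk_eq
    exact comul_gen_mem_range h𝒦 (Set.subset_union_left.trans Algebra.subset_adjoin) hΓ
  · have hxB := Algebra.subset_adjoin (R := ℚ) (Set.subset_union_right (s := UTwoGraph.gen '' 𝒦) hx)
    obtain ⟨_, -, ⟨G, hG, rfl⟩, hx⟩ := hx
    rw [SetLike.mem_coe, Subalgebra.mem_comap, comul_of_mul_gen_eq_one hG hx]
    exact tmul_mem_range hxB hxB

theorem gen_mem_augGraphSubalgebra {G : TwoGraph} (hG : UTwoGraph.mk G ∈ 𝒦) :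
    G.gen ∈ augGraphSubalgebra 𝒦 :=
  Algebra.subset_adjoin (Or.inl ⟨_, hG, rfl⟩)

/-- Every ingredient of the recursion for the antipode stays inside: subgraphs and contractions by
closedness of `𝒦`, and the only inverse needed is that of the residue `G / ⊤`, itself in `𝒦`. This
is why exactly the inverses of residues in `𝒦` are adjoined. -/
theorem antipode_gen_mem (h𝒦 : UTwoGraph.IsClosed 𝒦) {G : TwoGraph} (hG : UTwoGraph.mk G ∈ 𝒦) :
    antipode G.gen ∈ augGraphSubalgebra 𝒦 := by
  induction hn : G.edgeSize using Nat.strong_induction_on generalizing G with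
  | _ n ih =>
  subst hn
  rw [antipode, convInvAlgHom_gen, convInv]
  refine mul_mem (sub_mem (Subalgebra.algebraMap_mem _ _) (sum_mem fun K _ => mul_mem ?_ ?_)) ?_
  · rw [← convInvAlgHom_gen]
    exact ih _ (edgeSize_toTwoGraph_lt K.2) (h𝒦.toTwoGraph_mem G hG K.1) rfl
  · exact gen_mem_augGraphSubalgebra (h𝒦.contract_mem G hG K.1)
  · refine Algebra.subset_adjoin (Or.inr ⟨_, h𝒦.contract_mem G hG ⊤,
      UTwoGraph.mk_mem_residues.mpr (isResidue_contract_top G), ?_⟩)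
    exact Ring.inverse_mul_cancel _ (isResidue_contract_top G).isUnit_gen

theorem antipode_mem (h𝒦 : UTwoGraph.IsClosed 𝒦) {x : AugTwoGraphAlgebra}
    (hx : x ∈ augGraphSubalgebra 𝒦) : antipode x ∈ augGraphSubalgebra 𝒦 := by
  suffices h : augGraphSubalgebra 𝒦 ≤ (augGraphSubalgebra 𝒦).comap antipode from h hx
  refine Algebra.adjoin_le ?_
  rintro x (⟨Γ, hΓ, rfl⟩ | ⟨_, hG𝒦, ⟨G, hG, rfl⟩, hx⟩)
  · obtain ⟨G, rfl⟩ := Γ.exists_mk_eq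
    exact antipode_gen_mem h𝒦 hΓ
  -- The antipode sends the inverse of a residue back to the residue: both `antipode x` and `G.gen`
  -- are inverse to `antipode G.gen`.
  · have h1 : antipode x * antipode G.gen = 1 := by
      rw [← map_mul, show x * G.gen = 1 from hx, map_one]
    have h2 : antipode G.gen * G.gen = 1 := by
      rw [antipode, convInvAlgHom_gen]
      exact convInv_mul_of_isResidue (AlgHom.id ℚ AugTwoGraphAlgebra) hG
    rw [SetLike.mem_coe, Subalgebra.mem_comap, left_inv_eq_right_inv h1 h2]
    exact gen_mem_augGraphSubalgebra hG𝒦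

end AugTwoGraphAlgebra

end

theorem theorem2 :
    ∃ (Δ : AugTwoGraphAlgebra →ₐ[ℚ] AugTwoGraphAlgebra ⊗[ℚ] AugTwoGraphAlgebra)
      (ε : AugTwoGraphAlgebra →ₐ[ℚ] ℚ)
      (S : AugTwoGraphAlgebra →ₗ[ℚ] AugTwoGraphAlgebra),
      -- the coproduct and the counit of 2-graphs
      (∀ G : TwoGraph, Δ G.gen = ∑ K : G.Subgraph, K.toTwoGraph.gen ⊗ₜ[ℚ] K.contract.gen) ∧
      (∀ G : TwoGraph, G.IsResidue → ε G.gen = 1) ∧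
      (∀ G : TwoGraph, ¬ G.IsResidue → ε G.gen = 0) ∧
      -- the bialgebra axioms
      (Algebra.TensorProduct.assoc ℚ ℚ ℚ AugTwoGraphAlgebra AugTwoGraphAlgebra
          AugTwoGraphAlgebra).toAlgHom.comp
          ((Algebra.TensorProduct.map Δ (AlgHom.id ℚ AugTwoGraphAlgebra)).comp Δ) =
        (Algebra.TensorProduct.map (AlgHom.id ℚ AugTwoGraphAlgebra) Δ).comp Δ ∧
      (Algebra.TensorProduct.map ε (AlgHom.id ℚ AugTwoGraphAlgebra)).comp Δ =
        (Algebra.TensorProduct.lid ℚ AugTwoGraphAlgebra).symm.toAlgHom ∧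
      (Algebra.TensorProduct.map (AlgHom.id ℚ AugTwoGraphAlgebra) ε).comp Δ =
        (Algebra.TensorProduct.rid ℚ ℚ AugTwoGraphAlgebra).symm.toAlgHom ∧
      -- the antipode and its uniqueness
      (∀ T : AugTwoGraphAlgebra →ₗ[ℚ] AugTwoGraphAlgebra,
        (convolution Δ.toLinearMap T LinearMap.id =
            Algebra.linearMap ℚ AugTwoGraphAlgebra ∘ₗ ε.toLinearMap ∧
          convolution Δ.toLinearMap LinearMap.id T =
            Algebra.linearMap ℚ AugTwoGraphAlgebra ∘ₗ ε.toLinearMap) ↔ T = S) ∧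
      -- the group of algebra homomorphisms into a commutative algebra
      (∀ (A : Type u) [CommRing A] [Algebra ℚ A],
        ∃ _ : Group (AugTwoGraphAlgebra →ₐ[ℚ] A),
          (∀ φ ψ : AugTwoGraphAlgebra →ₐ[ℚ] A, (φ * ψ).toLinearMap =
            convolution Δ.toLinearMap φ.toLinearMap ψ.toLinearMap) ∧
          (1 : AugTwoGraphAlgebra →ₐ[ℚ] A) = (Algebra.ofId ℚ A).comp ε ∧
          ∀ φ : AugTwoGraphAlgebra →ₐ[ℚ] A, (φ⁻¹).toLinearMap = φ.toLinearMap ∘ₗ S) ∧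
      -- the Hopf subalgebras given by sets of vertex types
      ∀ 𝒱 : Set UOneGraph,
        IsSubbialgebra Δ.toLinearMap
          (graphSubalgebra (UTwoGraph.contractionClosure (UTwoGraph.ofVertexTypes 𝒱))) ∧
        IsSubbialgebra Δ.toLinearMap
          (augGraphSubalgebra (UTwoGraph.contractionClosure (UTwoGraph.ofVertexTypes 𝒱))) ∧
        ∀ x ∈ augGraphSubalgebra (UTwoGraph.contractionClosure (UTwoGraph.ofVertexTypes 𝒱)),
          S x ∈ augGraphSubalgebra (UTwoGraph.contractionClosure (UTwoGraph.ofVertexTypes 𝒱)) := by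
  exact ⟨AugTwoGraphAlgebra.comul, AugTwoGraphAlgebra.counit,
    AugTwoGraphAlgebra.antipode.toLinearMap, AugTwoGraphAlgebra.comul_gen,
    fun _ => AugTwoGraphAlgebra.counit_gen_of_isResidue,
    fun _ => AugTwoGraphAlgebra.counit_gen_of_not_isResidue, AugTwoGraphAlgebra.coassoc,
    AugTwoGraphAlgebra.counit_comul, AugTwoGraphAlgebra.comul_counit, convolution_id_eq_iff,
    fun A _ _ => exists_group_algHom A, fun 𝒱 =>
      have h𝒦 := UTwoGraph.isClosed_contractionClosure 𝒱
      ⟨AugTwoGraphAlgebra.isSubbialgebra_graphSubalgebra h𝒦,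
        AugTwoGraphAlgebra.isSubbialgebra_augGraphSubalgebra h𝒦,
        fun _ => AugTwoGraphAlgebra.antipode_mem h𝒦⟩⟩
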